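/- Let $p\in(2,3)$, $T>0$, $d\in\mathbb N_0$ and $\hat d=1+d+\frac{d(d+1)}2$. Write $\Delta_T=\{(s,t):0\le s\le t\le T\}$ and, for a path $X$, $X_{s,t}=X_t-X_s$. For $r>0$ and a two-parameter function $A$ on $\Delta_T$ put $\|A\|_r=\big(\sup_{\mathcal P}\sum_{[u,v]\in\mathcal P}|A_{u,v}|^r\big)^{1/r}$, the supremum being over the partitions of $[0,T]$ and $|\cdot|$ the Euclidean norm; for a path, $\|X\|_r$ is the $r$-variation of its increments. A rough path over $\mathbb R^n$ is a pair $\mathbf X=(X,\mathbb X^{(2)})$ of continuous functions $X:[0,T]\to\mathbb R^n$, $\mathbb X^{(2)}:\Delta_T\to\mathbb R^{n\times n}$ with $\|X\|_p<\infty$, $\|\mathbb X^{(2)}\|_{p/2}<\infty$ and $\mathbb X^{(2)}_{s,t}=\mathbb X^{(2)}_{s,u}+\mathbb X^{(2)}_{u,t}+X_{s,u}\otimes X_{u,t}$ for $0\le s\le u\le t\le T$; it need not be weakly geometric. Let $\|\mathbf X\|_p=\|X\|_p+\|\mathbb X^{(2)}\|_{p/2}$, let $[\mathbf X]_t=X_{0,t}\otimes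 X_{0,t}-\big(\mathbb X^{(2)}_{0,t}+(\mathbb X^{(2)}_{0,t})^\top\big)$ be its bracket, and equip the space of rough paths with the topology of the pseudo-distance $\|X-Y\|_p+\|\mathbb X^{(2)}-\mathbb Y^{(2)}\|_{p/2}$. The signature of $\mathbf X$ is its Lyons extension: the unique continuous $(s,t)\mapsto\mathbb X_{s,t}\in T((\mathbb R^n))=\prod_{k\ge0}(\mathbb R^n)^{\otimes k}$ on $\Delta_T$ with levels $0,1,2$ equal to $1,X_{s,t},\mathbb X^{(2)}_{s,t}$, with $\mathbb X_{s,t}=\mathbb X_{s,u}\otimes\mathbb X_{u,t}$ for $s\le u\le t$, and with level $k$ of finite $p/k$-variation for every $k\ge1$. Write $\mathbb X_T=\mathbb X_{0,T}$. Let $\widehat{\mathcal C}^p$ be the set of the rough paths $\widehat{\mathbf X}=(\widehat X,\widehat{\mathbb X}^{(2)})$ over $\mathbb R^{\hat d}$ obtained from rough paths $(X,\mathbb X^{(2)})$ over $\mathbb R^d$ as follows: $\widehat X_t=(t,X_t,Q(X)_t)$ with $Q(X)=([\mathbf X]^{ij})_{1\le i\le j\le d}$; the component of $\widehat{\mathbb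 X}^{(2)}$ at two coordinates of $X$ is that of $\mathbb X^{(2)}$, and at every other pair $(a,b)$ of coordinates it is the Young integral $\int_s^t\widehat X^a_{s,r}\,\mathrm d\widehat X^b_r$. Let $K\subset\widehat{\mathcal C}^p$ be compact (hence bounded), $f:K\to\mathbb R$ continuous, $L>0$, and $K_L=\{\widehat{\mathbf X}\in K:\ \|\widehat{\mathbf X}\|_p+\|[\widehat{\mathbf X}]\|_{p/2}\le L\}$. Then every $\widehat{\mathbf X}\in K$ has exactly one Lyons extension $\widehat{\mathbb X}$, and for every $\epsilon>0$ there is $\ell\in T(\mathbb R^{\hat d})=\bigoplus_{k\ge0}(\mathbb R^{\hat d})^{\otimes k}$ such that $$\sup_{\widehat{\mathbf X}\in K_L}\big|f(\widehat{\mathbf X})-\langle\ell,\widehat{\mathbb X}_T\rangle\big|<\epsilon .$$ -/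

import Mathlib

open scoped ENNReal

noncomputable section

namespace RoughUAT

/-! Paths on `[0,T]` are total functions on `ℝ`, and two-parameter functions on the simplex
`0 ≤ s ≤ t ≤ T` are total functions `ℝ → ℝ → E`. All conditions and all quantities below only
involve times in `[0,T]`, respectively in the simplex, so the other values are irrelevant. -/

/-- The simplex `Δ_T`. -/
def simplex (T : ℝ) : Set (ℝ × ℝ) := {x | 0 ≤ x.1 ∧ x.1 ≤ x.2 ∧ x.2 ≤ T}

/-- `u 0 < u 1 < ⋯ < u N` is a partition of `[s,t]`. -/
def IsPartition (s t : ℝ) (N : ℕ) (u : ℕ → ℝ) : Prop :=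
  u 0 = s ∧ u N = t ∧ ∀ i < N, u i < u (i + 1)

/-- The `r`-variation of a two-parameter function over `[s,t]`, possibly infinite. -/
def rVar {E : Type*} [NormedAddCommGroup E] (r : ℝ) (A : ℝ → ℝ → E) (s t : ℝ) : ℝ≥0∞ :=
  (⨆ (N : ℕ) (u : ℕ → ℝ) (_ : IsPartition s t N u),
    ∑ i ∈ Finset.range N, ‖A (u i) (u (i + 1))‖ₑ ^ r) ^ (1 / r)

/-- The increments `X_{s,t} = X_t - X_s` of a path. -/
def incr {E : Type*} [NormedAddCommGroup E] (X : ℝ → E) (s t : ℝ) : E := X t - X s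

/-- Rough paths of finite `p`-variation over `ℝ^ι` on `[0,T]`, for `p ∈ [2,3)`; the second level
takes values in `ℝ^{ι × ι} = ℝ^ι ⊗ ℝ^ι` with the Euclidean norm. -/
structure RoughPath (p T : ℝ) (ι : Type*) [Fintype ι] where
  two_le : 2 ≤ p
  lt_three : p < 3
  path : ℝ → EuclideanSpace ℝ ι
  lift : ℝ → ℝ → EuclideanSpace ℝ (ι × ι)
  path_continuousOn : ContinuousOn path (Set.Icc 0 T)
  lift_continuousOn : ContinuousOn (fun x : ℝ × ℝ => lift x.1 x.2) (simplex T)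
  path_rVar : rVar p (incr path) 0 T < ∞
  lift_rVar : rVar (p / 2) lift 0 T < ∞
  chen : ∀ s u t : ℝ, 0 ≤ s → s ≤ u → u ≤ t → t ≤ T → ∀ i j : ι,
    lift s t (i, j) = lift s u (i, j) + lift u t (i, j) + incr path s u i * incr path u t j

theorem rVar_zero {E : Type*} [NormedAddCommGroup E] {r : ℝ} (hr : 0 < r) (s t : ℝ) :
    rVar r (fun _ _ => (0 : E)) s t = 0 := by
  simp [rVar, hr]

theorem rVar_congr {E : Type*} [NormedAddCommGroup E] {r : ℝ} {A B : ℝ → ℝ → E}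
    (h : ∀ u v, ‖A u v‖ₑ = ‖B u v‖ₑ) (s t : ℝ) : rVar r A s t = rVar r B s t := by
  simp only [rVar, h]

theorem rVar_add_le {E : Type*} [NormedAddCommGroup E] {r : ℝ} (hr : 1 ≤ r)
    (A B : ℝ → ℝ → E) (s t : ℝ) :
    rVar r (fun u v => A u v + B u v) s t ≤ rVar r A s t + rVar r B s t := by
  have hr0 : 0 < r := by linarith
  have key : ∀ (C : ℝ → ℝ → E) (N : ℕ) (u : ℕ → ℝ), IsPartition s t N u →
      (∑ i ∈ Finset.range N, ‖C (u i) (u (i + 1))‖ₑ ^ r) ^ (1 / r) ≤ rVar r C s t := by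
    intro C N u hu
    refine ENNReal.rpow_le_rpow ?_ (by positivity)
    exact le_iSup_of_le N (le_iSup_of_le u (le_iSup_of_le hu le_rfl))
  rw [rVar, one_div, ENNReal.rpow_inv_le_iff hr0]
  refine iSup_le fun N => iSup_le fun u => iSup_le fun hu => ?_
  rw [← ENNReal.rpow_inv_le_iff hr0, ← one_div]
  calc (∑ i ∈ Finset.range N, ‖A (u i) (u (i + 1)) + B (u i) (u (i + 1))‖ₑ ^ r) ^ (1 / r)
      ≤ (∑ i ∈ Finset.range N,
          (‖A (u i) (u (i + 1))‖ₑ + ‖B (u i) (u (i + 1))‖ₑ) ^ r) ^ (1 / r) := by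
        gcongr
        exact enorm_add_le _ _
    _ ≤ _ := ENNReal.Lp_add_le _ _ _ hr
    _ ≤ _ := add_le_add (key A N u hu) (key B N u hu)

namespace RoughPath

variable {p T : ℝ} {ι : Type*} [Fintype ι]

/-- The rough path distance `‖X - Y‖_p + ‖𝕏 - 𝕐‖_{p/2}`. It is a pseudo-distance: like the rough
path seminorm, it does not see the starting points of the paths. -/
instance : PseudoEMetricSpace (RoughPath p T ι) where
  edist X Y := rVar p (fun s t => incr X.path s t - incr Y.path s t) 0 T
    + rVar (p / 2) (fun s t => X.lift s t - Y.lift s t) 0 T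
  edist_self X := by
    have := X.two_le
    simp only [sub_self]
    rw [rVar_zero (by linarith), rVar_zero (by linarith), add_zero]
  edist_comm X Y := by
    congr 1 <;> exact rVar_congr (fun u v => by rw [← enorm_neg, neg_sub]) _ _
  edist_triangle X Y Z := by
    have := X.two_le
    have h1 := rVar_add_le (r := p) (by linarith)
      (fun s t => incr X.path s t - incr Y.path s t)
      (fun s t => incr Y.path s t - incr Z.path s t) 0 T
    have h2 := rVar_add_le (r := p / 2) (by linarith)
      (fun s t => X.lift s t - Y.lift s t) (fun s t => Y.lift s t - Z.lift s t) 0 T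
    simp only [sub_add_sub_cancel] at h1 h2
    refine (add_le_add h1 h2).trans (le_of_eq ?_)
    ring

/-- The rough path seminorm `‖X‖_p + ‖𝕏‖_{p/2}` on `[0,T]`. -/
def seminorm (X : RoughPath p T ι) : ℝ≥0∞ :=
  rVar p (incr X.path) 0 T + rVar (p / 2) X.lift 0 T

/-- The rough path bracket `[X]_t = X_{0,t} ⊗ X_{0,t} - (𝕏_{0,t} + 𝕏_{0,t}ᵀ)`. -/
def bracket (X : RoughPath p T ι) (t : ℝ) : EuclideanSpace ℝ (ι × ι) :=
  WithLp.toLp 2 fun ij => incr X.path 0 t ij.1 * incr X.path 0 t ij.2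
    - (X.lift 0 t ij + X.lift 0 t ij.swap)

end RoughPath

/-! ### The extended tensor algebra and Lyons' extension -/

/-- Elements `𝐚 = ∑_I a_I e_I` of `T((ℝ^ι))`, given by their coordinates on words. -/
abbrev TensorSeries (ι : Type*) := List ι → ℝ

/-- The component in `(ℝ^ι)^{⊗ n}`, with the Euclidean norm. -/
def TensorSeries.level {ι : Type*} (n : ℕ) (a : TensorSeries ι) :
    EuclideanSpace ℝ (Fin n → ι) :=
  WithLp.toLp 2 fun w => a (List.ofFn w)

/-- The tensor multiplication `⊗` of `T((ℝ^ι))`: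
the coordinate on a word is the sum over all ways to cut the word in two. -/
def TensorSeries.tmul {ι : Type*} (a b : TensorSeries ι) : TensorSeries ι :=
  fun I => ∑ k ∈ Finset.range (I.length + 1), a (I.take k) * b (I.drop k)

/-- The pairing `⟨ℓ, 𝐚⟩ = ∑_I ℓ_I a_I` of `ℓ ∈ T(ℝ^ι)` (finitely many non-zero coordinates) with
`𝐚 ∈ T((ℝ^ι))`. -/
def pairing {ι : Type*} (ℓ : List ι →₀ ℝ) (a : TensorSeries ι) : ℝ :=
  ℓ.sum fun I c => c * a I

/-- `S` is a Lyons extension of the rough path `X`: a continuous multiplicative functional with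
values in `T((ℝ^ι))`, of finite `p`-variation (that is, with level `n` of finite `p/n`-variation),
which extends `(1, X, 𝕏)`. -/
structure IsLyonsExtension {p T : ℝ} {ι : Type*} [Fintype ι] (X : RoughPath p T ι)
    (S : ℝ → ℝ → TensorSeries ι) : Prop where
  level_zero : ∀ s t : ℝ, (s, t) ∈ simplex T → S s t [] = 1
  level_one : ∀ s t : ℝ, (s, t) ∈ simplex T → ∀ i, S s t [i] = incr X.path s t i
  level_two : ∀ s t : ℝ, (s, t) ∈ simplex T → ∀ i j, S s t [i, j] = X.lift s t (i, j)
  chen : ∀ s u t : ℝ, 0 ≤ s → s ≤ u → u ≤ t → t ≤ T →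
    S s t = TensorSeries.tmul (S s u) (S u t)
  continuousOn : ∀ n : ℕ,
    ContinuousOn (fun x : ℝ × ℝ => TensorSeries.level n (S x.1 x.2)) (simplex T)
  rVar_lt : ∀ n : ℕ, 1 ≤ n → rVar (p / n) (fun s t => TensorSeries.level n (S s t)) 0 T < ∞

open Classical in
/-- The signature `(s,t) ↦ 𝕏_{s,t}` of a rough path: its Lyons extension. -/
def signature {p T : ℝ} {ι : Type*} [Fintype ι] (X : RoughPath p T ι) :
    ℝ → ℝ → TensorSeries ι :=
  if h : ∃ S, IsLyonsExtension X S then h.choose else 0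

/-! ### Extension by time and by the bracket terms -/

/-- Indices of the extended path `(t, X, Q(X))`: time, the `d` components of `X`, and the pairs
`i ≤ j` for the components of the bracket. -/
abbrev ExtIndex (d : ℕ) := Unit ⊕ Fin d ⊕ {ij : Fin d × Fin d // ij.1 ≤ ij.2}

/-- The index of the component `i` of `X` in the extended path. -/
abbrev ExtIndex.ofPath {d : ℕ} (i : Fin d) : ExtIndex d := Sum.inr (Sum.inl i)

/-- The extended path `(t, X_t, Q(X)_t)`. -/
def extPath {p T : ℝ} {d : ℕ} (X : RoughPath p T (Fin d)) (t : ℝ) :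
    EuclideanSpace ℝ (ExtIndex d) :=
  WithLp.toLp 2 (Sum.elim (fun _ => t) (Sum.elim (fun i => X.path t i)
    (fun ij => X.bracket t ij.1)))

/-- `J = ∫_s^t F dG` as a Young integral: the limit of the Riemann sums
`∑ F_u (G_v - G_u)` along the partitions of `[s,t]` as the mesh tends to zero. -/
def IsYoungIntegral (F G : ℝ → ℝ) (s t J : ℝ) : Prop :=
  ∀ ε > 0, ∃ δ > 0, ∀ (N : ℕ) (u : ℕ → ℝ), IsPartition s t N u →
    (∀ i < N, u (i + 1) - u i < δ) →
    |∑ i ∈ Finset.range N, F (u i) * (G (u (i + 1)) - G (u i)) - J| < ε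

/-- The space of rough paths extended by time and by the rough path bracket: the canonical lifts
of `(t, X, Q(X))` for rough paths `(X, 𝕏)` over `ℝ^d`. The second level of the canonical lift is
`𝕏` on the components of `X`, and a Young integral on all other pairs of components. -/
def extendedRoughPaths (p T : ℝ) (d : ℕ) : Set (RoughPath p T (ExtIndex d)) :=
  {Y | ∃ X : RoughPath p T (Fin d),
    (∀ t ∈ Set.Icc 0 T, Y.path t = extPath X t) ∧
    (∀ s t : ℝ, (s, t) ∈ simplex T → ∀ i j : Fin d,
      Y.lift s t (ExtIndex.ofPath i, ExtIndex.ofPath j) = X.lift s t (i, j)) ∧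
    (∀ s t : ℝ, (s, t) ∈ simplex T → ∀ a b : ExtIndex d,
      ¬ (a ∈ Set.range ExtIndex.ofPath ∧ b ∈ Set.range ExtIndex.ofPath) →
      IsYoungIntegral (fun r => incr Y.path s r a) (fun r => Y.path r b) s t
        (Y.lift s t (a, b)))}

/-- The part of `K` on which `‖(X, 𝕏)‖_p + ‖[X]‖_{p/2} ≤ L`. -/
def boundedPart {p T : ℝ} {ι : Type*} [Fintype ι] (K : Set (RoughPath p T ι)) (L : ℝ) :
    Set (RoughPath p T ι) :=
  {X ∈ K | X.seminorm + rVar (p / 2) (incr X.bracket) 0 T ≤ ENNReal.ofReal L}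

end RoughUAT

end

/-! Give the letters of the path weight `1` and the letters of time and of the bracket weight `2`.
With respect to a control of the rough path, the signature coordinate on a word of weight `k` is of
order `k / p`. An additive function of intervals of order greater than `1` vanishes, so every
identity between coordinates follows, by induction along Chen's relation, from its cases of weight
at most `2`. Three consequences are used.

* Each coordinate is continuous in the rough path, with a bound that depends on the control only.
* The product of two coordinates is the sum over their quasi-shuffles, where two letters of the path
  may merge into the letter of their bracket. This replaces the shuffle identity, which needs a
  weakly geometric rough path, and makes the linear functionals of the signature an algebra.
* Appending the letter of time integrates a coordinate against `dt`. Hence the terminal signature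
  contains all the integrals of `S_{0,r} (T - r) ^ k` over `[0, T]`, and these moments determine
  `S_{0,r}` at every time `r`; its levels `1` and `2` are the rough path.

The Stone-Weierstrass theorem on the compact set of extended rough paths concludes, rough paths at
distance zero having the same signature.
-/

noncomputable section

namespace RoughUAT

open Filter Topology

/-! ### Partitions and controls -/

section Partition

variable {s t r T : ℝ} {N M : ℕ} {u v : ℕ → ℝ}

theorem IsPartition.le (h : IsPartition s t N u) {i j : ℕ} (hij : i ≤ j) (hj : j ≤ N) :
    u i ≤ u j := by
  induction j, hij using Nat.le_induction with
  | base => exact le_rfl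
  | succ j _ ih => exact (ih (by omega)).trans (h.2.2 j (by omega)).le

theorem IsPartition.left_le (h : IsPartition s t N u) {i : ℕ} (hi : i ≤ N) : s ≤ u i :=
  h.1 ▸ h.le (Nat.zero_le i) hi

theorem IsPartition.le_right (h : IsPartition s t N u) {i : ℕ} (hi : i ≤ N) : u i ≤ t :=
  h.2.1 ▸ h.le hi le_rfl

theorem IsPartition.mem_simplex (h : IsPartition s t N u) (hst : (s, t) ∈ simplex T) {i : ℕ}
    (hi : i < N) : (u i, u (i + 1)) ∈ simplex T :=
  ⟨hst.1.trans (h.left_le hi.le), (h.2.2 i hi).le, (h.le_right hi).trans hst.2.2⟩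

theorem isPartition_refl (s : ℝ) : IsPartition s s 0 fun _ => s :=
  ⟨rfl, rfl, fun _ hi => absurd hi (Nat.not_lt_zero _)⟩

theorem isPartition_pair (h : s < t) : IsPartition s t 1 fun i => if i = 0 then s else t :=
  ⟨by simp, by simp, fun i hi => by simpa [Nat.lt_one_iff.1 hi] using h⟩

theorem IsPartition.take (h : IsPartition s t N u) {j : ℕ} (hj : j ≤ N) :
    IsPartition s (u j) j u :=
  ⟨h.1, rfl, fun i hi => h.2.2 i (hi.trans_le hj)⟩

theorem IsPartition.drop (h : IsPartition s t N u) {j : ℕ} (hj : j ≤ N) :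
    IsPartition (u j) t (N - j) fun i => u (j + i) :=
  ⟨rfl, by simp only [Nat.add_sub_cancel' hj, h.2.1], fun i hi => h.2.2 (j + i) (by omega)⟩

/-- The concatenation of the times `u 0, …, u N` and `v 0, v 1, …`, where `u N = v 0`. -/
def concat (N : ℕ) (u v : ℕ → ℝ) (i : ℕ) : ℝ := if i ≤ N then u i else v (i - N)

theorem concat_left {i : ℕ} (hi : i ≤ N) : concat N u v i = u i := if_pos hi

theorem concat_right (h : u N = v 0) (i : ℕ) : concat N u v (N + i) = v i := by
  rcases Nat.eq_zero_or_pos i with rfl | hi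
  · simp [concat, h]
  · rw [concat, if_neg (by omega), Nat.add_sub_cancel_left]

theorem IsPartition.concat (hu : IsPartition s t N u) (hv : IsPartition t r M v) :
    IsPartition s r (N + M) (concat N u v) := by
  have h : u N = v 0 := hu.2.1.trans hv.1.symm
  refine ⟨by rw [concat_left (Nat.zero_le _), hu.1], by rw [concat_right h, hv.2.1],
    fun i hi => ?_⟩
  rcases Nat.lt_or_ge i N with hiN | hiN
  · rw [concat_left hiN.le, concat_left hiN]
    exact hu.2.2 i hiN
  · obtain ⟨k, rfl⟩ := Nat.exists_eq_add_of_le hiN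
    rw [concat_right h, add_assoc, concat_right h]
    exact hv.2.2 k (by omega)

theorem sum_concat {E : Type*} [AddCommMonoid E] (h : u N = v 0) (g : ℝ → ℝ → E) :
    ∑ i ∈ Finset.range (N + M), g (concat N u v i) (concat N u v (i + 1))
      = ∑ i ∈ Finset.range N, g (u i) (u (i + 1)) + ∑ i ∈ Finset.range M, g (v i) (v (i + 1)) := by
  rw [Finset.sum_range_add]
  congr 1
  · refine Finset.sum_congr rfl fun i hi => ?_
    rw [Finset.mem_range] at hi
    rw [concat_left hi.le, concat_left hi]
  · refine Finset.sum_congr rfl fun i _ => ?_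
    rw [concat_right h, add_assoc, concat_right h]

end Partition

/-- Controls on `[0,T]`: non-negative superadditive functions of intervals which tend to zero on
intervals shrinking to one of their end points. Continuity in both end points is not required. -/
structure IsControl (T : ℝ) (ω : ℝ → ℝ → ℝ) : Prop where
  nonneg : ∀ {s t : ℝ}, (s, t) ∈ simplex T → 0 ≤ ω s t
  superadd : ∀ {s u t : ℝ}, 0 ≤ s → s ≤ u → u ≤ t → t ≤ T → ω s u + ω u t ≤ ω s t
  tendsto_right : ∀ m ∈ Set.Ico 0 T, Tendsto (ω m) (𝓝[>] m) (𝓝 0)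
  tendsto_left : ∀ m ∈ Set.Ioc 0 T, Tendsto (fun s => ω s m) (𝓝[<] m) (𝓝 0)

/-- Functions of intervals which are additive under concatenation of intervals. -/
def IsAdditive {E : Type*} [Add E] (T : ℝ) (A : ℝ → ℝ → E) : Prop :=
  ∀ s u t : ℝ, 0 ≤ s → s ≤ u → u ≤ t → t ≤ T → A s t = A s u + A u t

/-- `A = O(ω ^ θ)` on the simplex, with constant `C`. -/
structure IsDominated {E : Type*} [Norm E] (T : ℝ) (ω : ℝ → ℝ → ℝ) (θ C : ℝ)
    (A : ℝ → ℝ → E) : Prop where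
  const_nonneg : 0 ≤ C
  norm_le : ∀ {s t : ℝ}, (s, t) ∈ simplex T → ‖A s t‖ ≤ C * ω s t ^ θ

theorem IsAdditive.eq_sum {E : Type*} [AddCommGroup E] {T : ℝ} {A : ℝ → ℝ → E}
    (hA : IsAdditive T A) {s t : ℝ} (hst : (s, t) ∈ simplex T) {N : ℕ} {u : ℕ → ℝ}
    (hu : IsPartition s t N u) : A s t = ∑ i ∈ Finset.range N, A (u i) (u (i + 1)) := by
  suffices ∀ n ≤ N, A s (u n) = ∑ i ∈ Finset.range n, A (u i) (u (i + 1)) by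
    rw [← this N le_rfl, hu.2.1]
  intro n hn
  induction n with
  | zero => simpa [hu.1] using hA s s s hst.1 le_rfl le_rfl (hst.2.1.trans hst.2.2)
  | succ n ih =>
    have hmem := hu.mem_simplex hst hn
    rw [Finset.sum_range_succ, ← ih (by omega)]
    exact hA _ _ _ hst.1 (hu.left_le (by omega)) hmem.2.1 hmem.2.2

/-- The end points `x` for which `[s,x]` has a partition into intervals on which `ω < η`. -/
def finelyReachable (ω : ℝ → ℝ → ℝ) (η s : ℝ) : Set ℝ :=
  {x | ∃ (N : ℕ) (u : ℕ → ℝ), IsPartition s x N u ∧ ∀ i < N, ω (u i) (u (i + 1)) < η}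

theorem mem_finelyReachable_of_lt {η s x y : ℝ} (hx : x ∈ finelyReachable ω η s) (hxy : x < y)
    (hlt : ω x y < η) : y ∈ finelyReachable ω η s := by
  obtain ⟨N, u, hu, hfine⟩ := hx
  refine ⟨N + 1, _, hu.concat (isPartition_pair hxy), fun i hi => ?_⟩
  rcases Nat.lt_or_ge i N with hiN | hiN
  · rw [concat_left hiN.le, concat_left hiN]
    exact hfine i hiN
  · obtain rfl : i = N := by omega
    rw [concat_left le_rfl, hu.2.1, concat_right (by simp [hu.2.1])]
    simpa using hlt

namespace IsControl

variable {T : ℝ} {ω : ℝ → ℝ → ℝ}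

theorem mono (hω : IsControl T ω) {s s' t' t : ℝ} (h0 : 0 ≤ s) (hs : s ≤ s') (hst : s' ≤ t')
    (ht : t' ≤ t) (hT : t ≤ T) : ω s' t' ≤ ω s t := by
  have hsplit := hω.superadd h0 hs (hst.trans ht) hT
  have hsplit' := hω.superadd (h0.trans hs) hst ht hT
  have hleft := hω.nonneg ⟨h0, hs, by linarith⟩
  have hright := hω.nonneg ⟨by linarith, ht, hT⟩
  linarith

theorem self_eq_zero (hω : IsControl T ω) {s : ℝ} (h0 : 0 ≤ s) (hT : s ≤ T) : ω s s = 0 := by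
  have hadd := hω.superadd h0 le_rfl le_rfl hT
  have hnonneg := hω.nonneg ⟨h0, le_rfl, hT⟩
  linarith

theorem add {ω' : ℝ → ℝ → ℝ} (hω : IsControl T ω) (hω' : IsControl T ω') :
    IsControl T fun s t => ω s t + ω' s t where
  nonneg h := add_nonneg (hω.nonneg h) (hω'.nonneg h)
  superadd h0 hsu hut hT := by
    linarith [hω.superadd h0 hsu hut hT, hω'.superadd h0 hsu hut hT]
  tendsto_right m hm := by simpa using (hω.tendsto_right m hm).add (hω'.tendsto_right m hm)
  tendsto_left m hm := by simpa using (hω.tendsto_left m hm).add (hω'.tendsto_left m hm)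

theorem length (T : ℝ) : IsControl T fun s t => t - s where
  nonneg h := sub_nonneg.2 h.2.1
  superadd _ _ _ _ := by linarith
  tendsto_right m _ := tendsto_nhdsWithin_of_tendsto_nhds <| by
    simpa using (continuous_id.sub continuous_const).tendsto (x := m) (f := fun t => t - m)
  tendsto_left m _ := tendsto_nhdsWithin_of_tendsto_nhds <| by
    simpa using (continuous_const.sub continuous_id).tendsto (x := m) (f := fun s => m - s)

theorem sum_le (hω : IsControl T ω) {s t : ℝ} (hst : (s, t) ∈ simplex T) {N : ℕ} {u : ℕ → ℝ}
    (hu : IsPartition s t N u) : ∑ i ∈ Finset.range N, ω (u i) (u (i + 1)) ≤ ω s t := by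
  suffices ∀ n ≤ N, ∑ i ∈ Finset.range n, ω (u i) (u (i + 1)) ≤ ω s (u n) from
    (this N le_rfl).trans_eq (by rw [hu.2.1])
  intro n hn
  induction n with
  | zero => simpa [hu.1] using hω.nonneg (s := s) (t := s) ⟨hst.1, le_rfl, hst.2.1.trans hst.2.2⟩
  | succ n ih =>
    have hmem := hu.mem_simplex hst hn
    rw [Finset.sum_range_succ]
    linarith [ih (by omega), hω.superadd hst.1 (hu.left_le (Nat.le_of_succ_le hn)) hmem.2.1
      hmem.2.2]

theorem exists_lt_right (hω : IsControl T ω) {m t η : ℝ} (hm : 0 ≤ m) (hmt : m < t) (ht : t ≤ T)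
    (hη : 0 < η) : ∃ y, m < y ∧ y ≤ t ∧ ω m y < η := by
  have hev := ((hω.tendsto_right m ⟨hm, hmt.trans_le ht⟩).eventually_lt_const hη).and
    (Ioc_mem_nhdsGT hmt)
  obtain ⟨y, hy, hmy, hyt⟩ := hev.exists
  exact ⟨y, hmy, hyt, hy⟩

theorem exists_lt_left (hω : IsControl T ω) {s m η : ℝ} (hs : 0 ≤ s) (hsm : s < m) (hm : m ≤ T)
    (hη : 0 < η) : ∃ y, s ≤ y ∧ y < m ∧ ω y m < η := by
  have hev := ((hω.tendsto_left m ⟨hs.trans_lt hsm, hm⟩).eventually_lt_const hη).and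
    (Ico_mem_nhdsLT hsm)
  obtain ⟨y, hy, hsy, hym⟩ := hev.exists
  exact ⟨y, hsy, hym, hy⟩

theorem exists_fine_partition (hω : IsControl T ω) {s t : ℝ} (hst : (s, t) ∈ simplex T) {η : ℝ}
    (hη : 0 < η) :
    ∃ (N : ℕ) (u : ℕ → ℝ), IsPartition s t N u ∧ ∀ i < N, ω (u i) (u (i + 1)) < η := by
  obtain ⟨h0, hst, hT⟩ := hst
  set G := finelyReachable ω η s ∩ Set.Icc s t
  have hsG : s ∈ G := ⟨⟨0, _, isPartition_refl s, fun _ h => absurd h (by omega)⟩, le_rfl, hst⟩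
  have hbdd : BddAbove G := ⟨t, fun x hx => hx.2.2⟩
  set x := sSup G
  have hsx : s ≤ x := le_csSup hbdd hsG
  have hxt : x ≤ t := csSup_le ⟨s, hsG⟩ fun y hy => hy.2.2
  have hxG : x ∈ finelyReachable ω η s := by
    rcases hsx.eq_or_lt with h | h
    · exact h ▸ hsG.1
    obtain ⟨y, hsy, hyx, hy⟩ := hω.exists_lt_left h0 h (hxt.trans hT) hη
    obtain ⟨g, hg, hyg⟩ := exists_lt_of_lt_csSup ⟨s, hsG⟩ hyx
    rcases (le_csSup hbdd hg).eq_or_lt with h' | h'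
    · exact (show g = x from h') ▸ hg.1
    · exact mem_finelyReachable_of_lt hg.1 h' <|
        (hω.mono (h0.trans hsy) hyg.le h'.le le_rfl (hxt.trans hT)).trans_lt hy
  rcases hxt.eq_or_lt with h | h
  · exact h ▸ hxG
  · obtain ⟨y, hxy, hyt, hy⟩ := hω.exists_lt_right (h0.trans hsx) h hT hη
    have hyG : y ∈ G := ⟨mem_finelyReachable_of_lt hxG hxy hy, hsx.trans hxy.le, hyt⟩
    exact absurd (le_csSup hbdd hyG) (not_le.2 hxy)

theorem exists_partition_sum_rpow_lt (hω : IsControl T ω) {s t : ℝ} (hst : (s, t) ∈ simplex T)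
    {θ : ℝ} (hθ : 1 < θ) {ε : ℝ} (hε : 0 < ε) :
    ∃ (N : ℕ) (u : ℕ → ℝ), IsPartition s t N u ∧
      ∑ i ∈ Finset.range N, ω (u i) (u (i + 1)) ^ θ < ε := by
  have hω0 : 0 ≤ ω s t := hω.nonneg hst
  set η : ℝ := (ε / (ω s t + 1)) ^ (1 / (θ - 1)) with hη_def
  have hη : 0 < η := by positivity
  obtain ⟨N, u, hu, hfine⟩ := hω.exists_fine_partition hst hη
  refine ⟨N, u, hu, ?_⟩
  have hle : ∀ i ∈ Finset.range N,
      ω (u i) (u (i + 1)) ^ θ ≤ η ^ (θ - 1) * ω (u i) (u (i + 1)) := by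
    intro i hi
    rw [Finset.mem_range] at hi
    have hn : 0 ≤ ω (u i) (u (i + 1)) := hω.nonneg (hu.mem_simplex hst hi)
    calc ω (u i) (u (i + 1)) ^ θ
        = ω (u i) (u (i + 1)) ^ (θ - 1) * ω (u i) (u (i + 1)) := by
          rw [← Real.rpow_add_one' hn (by linarith), sub_add_cancel]
      _ ≤ η ^ (θ - 1) * ω (u i) (u (i + 1)) := by
          gcongr
          exact (hfine i hi).le
  calc ∑ i ∈ Finset.range N, ω (u i) (u (i + 1)) ^ θ
      ≤ η ^ (θ - 1) * ∑ i ∈ Finset.range N, ω (u i) (u (i + 1)) := by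
        rw [Finset.mul_sum]
        exact Finset.sum_le_sum hle
    _ ≤ η ^ (θ - 1) * ω s t := by
        gcongr
        exact hω.sum_le hst hu
    _ = ε / (ω s t + 1) * ω s t := by
        rw [hη_def, ← Real.rpow_mul (by positivity), one_div_mul_cancel (by linarith),
          Real.rpow_one]
    _ < ε := by
        rw [div_mul_eq_mul_div, div_lt_iff₀ (by linarith)]
        nlinarith

end IsControl

/-- The sums of `A` over suitable partitions of any interval are arbitrarily small. -/
def HasVanishingSums {E : Type*} [NormedAddCommGroup E] (T : ℝ) (A : ℝ → ℝ → E) : Prop :=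
  ∀ s t : ℝ, (s, t) ∈ simplex T → ∀ ε > 0, ∃ (N : ℕ) (u : ℕ → ℝ), IsPartition s t N u ∧
    ‖∑ i ∈ Finset.range N, A (u i) (u (i + 1))‖ < ε

section Dominated

variable {E : Type*} [NormedAddCommGroup E] {T θ C : ℝ} {ω : ℝ → ℝ → ℝ} {A : ℝ → ℝ → E}

theorem IsDominated.norm_sum_le (hA : IsDominated T ω θ C A) {s t : ℝ}
    (hst : (s, t) ∈ simplex T) {N : ℕ} {u : ℕ → ℝ} (hu : IsPartition s t N u) :
    ‖∑ i ∈ Finset.range N, A (u i) (u (i + 1))‖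
      ≤ C * ∑ i ∈ Finset.range N, ω (u i) (u (i + 1)) ^ θ := by
  rw [Finset.mul_sum]
  refine norm_sum_le_of_le _ fun i hi => ?_
  exact hA.norm_le (hu.mem_simplex hst (Finset.mem_range.1 hi))

theorem IsControl.hasVanishingSums (hω : IsControl T ω) (hθ : 1 < θ)
    (hA : IsDominated T ω θ C A) : HasVanishingSums T A := by
  intro s t hst ε hε
  have hC := hA.const_nonneg
  obtain ⟨N, u, hu, hlt⟩ := hω.exists_partition_sum_rpow_lt hst hθ
    (show 0 < ε / (C + 1) by positivity)
  refine ⟨N, u, hu, ?_⟩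
  calc ‖∑ i ∈ Finset.range N, A (u i) (u (i + 1))‖
      ≤ C * ∑ i ∈ Finset.range N, ω (u i) (u (i + 1)) ^ θ := hA.norm_sum_le hst hu
    _ ≤ C * (ε / (C + 1)) := by gcongr
    _ < ε := by
        rw [← mul_div_assoc, div_lt_iff₀ (by linarith)]
        nlinarith

theorem IsAdditive.eq_zero (hA : IsAdditive T A) (hsum : HasVanishingSums T A) {s t : ℝ}
    (hst : (s, t) ∈ simplex T) : A s t = 0 := by
  refine norm_le_zero_iff.1 (le_of_forall_pos_lt_add fun ε hε => ?_)
  obtain ⟨N, u, hu, hlt⟩ := hsum s t hst ε hε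
  rwa [hA.eq_sum hst hu, zero_add]

end Dominated

/-! ### The sewing lemma -/

/-- The geometric series `2 ∑ₖ (2 ^ (1 - θ)) ^ k` arising from repeated halving of a control. -/
def sewingConst (θ : ℝ) : ℝ := 2 / (1 - 2 * (1 / 2) ^ θ)

theorem two_mul_half_rpow_lt_one {θ : ℝ} (hθ : 1 < θ) : 2 * (1 / 2 : ℝ) ^ θ < 1 := by
  have := Real.rpow_lt_rpow_of_exponent_gt (x := 1 / 2) (by norm_num) (by norm_num) hθ
  rw [Real.rpow_one] at this
  linarith

theorem sewingConst_pos {θ : ℝ} (hθ : 1 < θ) : 0 < sewingConst θ :=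
  div_pos two_pos (by linarith [two_mul_half_rpow_lt_one hθ])

theorem sewingConst_eq {θ : ℝ} (hθ : 1 < θ) :
    2 + 2 * (1 / 2) ^ θ * sewingConst θ = sewingConst θ := by
  have h : 1 - 2 * (1 / 2 : ℝ) ^ θ ≠ 0 := by linarith [two_mul_half_rpow_lt_one hθ]
  unfold sewingConst
  field_simp
  ring

theorem two_mul_rpow_add_sewingConst_le {θ x y W : ℝ} (hθ : 1 < θ) (hx : 0 ≤ x) (hy : 0 ≤ y)
    (hxW : x ≤ W / 2) (hyW : y ≤ W / 2) :
    2 * W ^ θ + sewingConst θ * x ^ θ + sewingConst θ * y ^ θ ≤ sewingConst θ * W ^ θ := by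
  have hK := (sewingConst_pos hθ).le
  have hhalf : ∀ z, 0 ≤ z → z ≤ W / 2 →
      sewingConst θ * z ^ θ ≤ sewingConst θ * ((1 / 2) ^ θ * W ^ θ) := by
    intro z hz hzW
    rw [← Real.mul_rpow (by norm_num) (by linarith)]
    gcongr
    linarith
  calc 2 * W ^ θ + sewingConst θ * x ^ θ + sewingConst θ * y ^ θ
      ≤ 2 * W ^ θ + sewingConst θ * ((1 / 2) ^ θ * W ^ θ)
        + sewingConst θ * ((1 / 2) ^ θ * W ^ θ) := by gcongr ?_ + ?_ + ?_ <;> simp only [*, le_refl]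
    _ = (2 + 2 * (1 / 2) ^ θ * sewingConst θ) * W ^ θ := by ring
    _ = sewingConst θ * W ^ θ := by rw [sewingConst_eq hθ]

/-- Functions of intervals whose defect of additivity is `O(ω ^ θ)`, with constant `C`. -/
structure IsAlmostAdditive {E : Type*} [NormedAddCommGroup E] (T : ℝ) (ω : ℝ → ℝ → ℝ)
    (θ C : ℝ) (Ξ : ℝ → ℝ → E) : Prop where
  const_nonneg : 0 ≤ C
  norm_sub_sub_le : ∀ {s u t : ℝ}, 0 ≤ s → s ≤ u → u ≤ t → t ≤ T →
    ‖Ξ s t - Ξ s u - Ξ u t‖ ≤ C * ω s t ^ θ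

section Sewing

variable {E : Type*} [NormedAddCommGroup E] {T θ C : ℝ} {ω : ℝ → ℝ → ℝ} {Ξ : ℝ → ℝ → E}

theorem IsAlmostAdditive.self_eq_zero (hω : IsControl T ω) (hθ : 1 < θ)
    (hΞ : IsAlmostAdditive T ω θ C Ξ) {s : ℝ} (h0 : 0 ≤ s) (hT : s ≤ T) : Ξ s s = 0 := by
  have h := hΞ.norm_sub_sub_le h0 le_rfl le_rfl hT
  rw [hω.self_eq_zero h0 hT, Real.zero_rpow (by linarith), mul_zero, sub_self, zero_sub,
    norm_neg] at h
  exact norm_le_zero_iff.1 h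

theorem IsControl.exists_le_half (hω : IsControl T ω) {s t : ℝ} (hst : (s, t) ∈ simplex T)
    {N : ℕ} {u : ℕ → ℝ} (hu : IsPartition s t (N + 1) u) :
    ∃ j ≤ N, ω s (u j) ≤ ω s t / 2 ∧ ω (u (j + 1)) t ≤ ω s t / 2 := by
  classical
  have hnonneg := hω.nonneg hst
  let P : ℕ → Prop := fun j => ω s (u j) ≤ ω s t / 2
  have hP0 : P 0 := by
    simp only [P, hu.1, hω.self_eq_zero hst.1 (hst.2.1.trans hst.2.2)]
    positivity
  refine ⟨Nat.findGreatest P N, Nat.findGreatest_le N,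
    Nat.findGreatest_spec (Nat.zero_le _) hP0, ?_⟩
  rcases (Nat.findGreatest_le N (P := P)).lt_or_eq with hlt | heq
  · have hgt : ω s t / 2 < ω s (u (Nat.findGreatest P N + 1)) :=
      not_le.1 (Nat.findGreatest_is_greatest (P := P) (Nat.lt_succ_self _) hlt)
    have hadd := hω.superadd hst.1 (hu.left_le (i := Nat.findGreatest P N + 1) (by omega))
      (hu.le_right (by omega)) hst.2.2
    linarith
  · rw [heq, hu.2.1, hω.self_eq_zero (hst.1.trans hst.2.1) hst.2.2]
    positivity

theorem IsAlmostAdditive.norm_sub_sub_sub_le (hω : IsControl T ω) (hθ : 0 ≤ θ)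
    (hΞ : IsAlmostAdditive T ω θ C Ξ) {s a b t : ℝ} (h0 : 0 ≤ s) (hsa : s ≤ a) (hab : a ≤ b)
    (hbt : b ≤ t) (hT : t ≤ T) :
    ‖Ξ s t - Ξ s a - Ξ a b - Ξ b t‖ ≤ C * (2 * ω s t ^ θ) := by
  have hC := hΞ.const_nonneg
  have hat : a ≤ t := hab.trans hbt
  calc ‖Ξ s t - Ξ s a - Ξ a b - Ξ b t‖
      = ‖(Ξ s t - Ξ s a - Ξ a t) + (Ξ a t - Ξ a b - Ξ b t)‖ := by congr 1; abel
    _ ≤ C * ω s t ^ θ + C * ω a t ^ θ :=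
        norm_add_le_of_le (hΞ.norm_sub_sub_le h0 hsa hat hT)
          (hΞ.norm_sub_sub_le (h0.trans hsa) hab hbt hT)
    _ ≤ C * ω s t ^ θ + C * ω s t ^ θ := by
        gcongr
        · exact hω.nonneg ⟨h0.trans hsa, hat, hT⟩
        · exact hω.mono h0 hsa hat le_rfl hT
    _ = C * (2 * ω s t ^ θ) := by ring

/-- Removing an interval around the middle of the partition halves the control on both sides, so
that the defects sum up to a geometric series. -/
theorem IsAlmostAdditive.norm_sub_sum_le (hω : IsControl T ω) (hθ : 1 < θ)
    (hΞ : IsAlmostAdditive T ω θ C Ξ) {s t : ℝ} (hst : (s, t) ∈ simplex T) {N : ℕ} {u : ℕ → ℝ}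
    (hu : IsPartition s t N u) :
    ‖Ξ s t - ∑ i ∈ Finset.range N, Ξ (u i) (u (i + 1))‖ ≤ C * (sewingConst θ * ω s t ^ θ) := by
  have hC := hΞ.const_nonneg
  induction N using Nat.strong_induction_on generalizing s t u with
  | _ N ih =>
  rcases N with _ | N
  · obtain rfl : s = t := hu.1.symm.trans hu.2.1
    have hK := sewingConst_pos hθ
    have hW := hω.nonneg hst
    rw [Finset.sum_range_zero, sub_zero, hΞ.self_eq_zero hω hθ hst.1 hst.2.2, norm_zero]
    positivity
  obtain ⟨j, hjN, hleft, hright⟩ := hω.exists_le_half hst hu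
  obtain ⟨h0, -, hT⟩ := hst
  have hsj : s ≤ u j := hu.left_le (by omega)
  have hjj : u j ≤ u (j + 1) := (hu.2.2 j (by omega)).le
  have hjt : u (j + 1) ≤ t := hu.le_right (by omega)
  have hmem_left : (s, u j) ∈ simplex T := ⟨h0, hsj, hjj.trans (hjt.trans hT)⟩
  have hmem_right : (u (j + 1), t) ∈ simplex T := ⟨h0.trans (hsj.trans hjj), hjt, hT⟩
  have hsum_left := ih j (by omega) hmem_left (hu.take (by omega))
  have hsum_right := ih _ (by omega) hmem_right (hu.drop (by omega))
  simp only [← add_assoc] at hsum_right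
  have hsum : ∑ i ∈ Finset.range (N + 1), Ξ (u i) (u (i + 1))
      = ∑ i ∈ Finset.range j, Ξ (u i) (u (i + 1)) + Ξ (u j) (u (j + 1))
        + ∑ i ∈ Finset.range (N + 1 - (j + 1)), Ξ (u (j + 1 + i)) (u (j + 1 + i + 1)) := by
    rw [← Finset.sum_range_succ (fun i => Ξ (u i) (u (i + 1))), ← Finset.sum_range_add,
      Nat.add_sub_cancel' (by omega)]
  rw [hsum]
  calc ‖Ξ s t - _‖
      = ‖(Ξ s t - Ξ s (u j) - Ξ (u j) (u (j + 1)) - Ξ (u (j + 1)) t) + (Ξ s (u j) - _)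
          + (Ξ (u (j + 1)) t - _)‖ := by congr 1; abel
    _ ≤ C * (2 * ω s t ^ θ) + C * (sewingConst θ * ω s (u j) ^ θ)
        + C * (sewingConst θ * ω (u (j + 1)) t ^ θ) :=
        norm_add_le_of_le (norm_add_le_of_le
          (hΞ.norm_sub_sub_sub_le hω (by linarith) h0 hsj hjj hjt hT) hsum_left) hsum_right
    _ ≤ C * (sewingConst θ * ω s t ^ θ) := by
        rw [← mul_add, ← mul_add]
        gcongr
        exact two_mul_rpow_add_sewingConst_le hθ (hω.nonneg hmem_left) (hω.nonneg hmem_right)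
          hleft hright

theorem IsAlmostAdditive.isDominated (hω : IsControl T ω) (hθ : 1 < θ)
    (hΞ : IsAlmostAdditive T ω θ C Ξ) (hsum : HasVanishingSums T Ξ) :
    IsDominated T ω θ (C * sewingConst θ) Ξ where
  const_nonneg := mul_nonneg hΞ.const_nonneg (sewingConst_pos hθ).le
  norm_le {s t} hst := by
    refine le_of_forall_pos_lt_add fun ε hε => ?_
    obtain ⟨N, u, hu, hlt⟩ := hsum s t hst ε hε
    have hle := hΞ.norm_sub_sum_le hω hθ hst hu
    rw [mul_assoc]
    linarith [norm_le_norm_add_norm_sub' (Ξ s t) (∑ i ∈ Finset.range N, Ξ (u i) (u (i + 1)))]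

/-- The sums along the partition of `[s,t]` by the points of `F` are the increments of one path. -/
theorem exists_incr_eq_sum (Ξ : ℝ → ℝ → E) (F : Finset ℝ) :
    ∃ Z : ℝ → E, ∀ s ∈ F, ∀ t ∈ F, s ≤ t → ∃ (N : ℕ) (u : ℕ → ℝ), IsPartition s t N u ∧
      incr Z s t = ∑ i ∈ Finset.range N, Ξ (u i) (u (i + 1)) := by
  classical
  induction F using Finset.induction_on_max with
  | empty => exact ⟨0, by simp⟩
  | insert m F hm ih =>
    obtain ⟨Z, hZ⟩ := ih
    have hrefl : ∃ (N : ℕ) (u : ℕ → ℝ), IsPartition m m N u ∧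
      (0 : E) = ∑ i ∈ Finset.range N, Ξ (u i) (u (i + 1)) := ⟨0, _, isPartition_refl m, by simp⟩
    rcases F.eq_empty_or_nonempty with rfl | hF
    · exact ⟨0, by simpa [incr] using hrefl⟩
    have hlast := F.max'_mem hF
    set l := F.max' hF
    refine ⟨Function.update Z m (Z l + Ξ l m), fun s hs t ht hst => ?_⟩
    rcases Finset.mem_insert.1 hs with rfl | hsF <;> rcases Finset.mem_insert.1 ht with rfl | htF
    · simpa [incr] using hrefl
    · exact absurd (hm t htF) hst.not_gt
    · obtain ⟨N, u, hu, hsum⟩ := hZ s hsF l hlast (F.le_max' s hsF)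
      refine ⟨N + 1, _, hu.concat (isPartition_pair (hm l hlast)), ?_⟩
      rw [sum_concat (by simp [hu.2.1]), ← hsum]
      simp [incr, Function.update_of_ne (hm s hsF).ne, add_sub_right_comm]
    · simpa [incr, Function.update_of_ne (hm s hsF).ne, Function.update_of_ne (hm t htF).ne]
        using hZ s hsF t htF hst

theorem IsAlmostAdditive.exists_sewing_finset (hω : IsControl T ω) (hθ : 1 < θ)
    (hΞ : IsAlmostAdditive T ω θ C Ξ) (F : Finset ℝ) :
    ∃ Z : ℝ → E, Z 0 = 0 ∧ ∀ s ∈ F, ∀ t ∈ F, (s, t) ∈ simplex T →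
      ‖Ξ s t - incr Z s t‖ ≤ C * (sewingConst θ * ω s t ^ θ) := by
  obtain ⟨Z, hZ⟩ := exists_incr_eq_sum Ξ F
  refine ⟨fun t => Z t - Z 0, sub_self _, fun s hs t ht hst => ?_⟩
  obtain ⟨N, u, hu, hsum⟩ := hZ s hs t ht hst.2.1
  rw [incr, sub_sub_sub_cancel_right, ← incr, hsum]
  exact hΞ.norm_sub_sum_le hω hθ hst hu

/-- The path is a limit, along an ultrafilter, of the paths obtained from finite sets of times. -/
theorem IsAlmostAdditive.exists_sewing [ProperSpace E] (hω : IsControl T ω) (hθ : 1 < θ)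
    (hΞ : IsAlmostAdditive T ω θ C Ξ) :
    ∃ Z : ℝ → E, IsDominated T ω θ (C * sewingConst θ) fun s t => Ξ s t - incr Z s t := by
  choose Z hZ0 hZ using hΞ.exists_sewing_finset hω hθ
  let U : Ultrafilter (Finset ℝ) := Ultrafilter.of atTop
  have hU : ∀ s t : ℝ, ∀ᶠ F in (U : Filter (Finset ℝ)), s ∈ F ∧ t ∈ F := fun s t => by
    filter_upwards [Ultrafilter.of_le atTop (eventually_ge_atTop {s, t})] with F hF
    exact ⟨hF (by simp), hF (by simp)⟩
  have hlim : ∀ t ∈ Set.Icc 0 T, ∃ z, Tendsto (fun F => Z F t) U (𝓝 z) := by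
    intro t ht
    have hev : ∀ᶠ F in (U : Filter (Finset ℝ)),
        Z F t ∈ Metric.closedBall (Ξ 0 t) (C * (sewingConst θ * ω 0 t ^ θ)) := by
      filter_upwards [hU 0 t] with F hF
      have := hZ F 0 hF.1 t hF.2 ⟨le_rfl, ht.1, ht.2⟩
      rwa [incr, hZ0, sub_zero, norm_sub_rev, ← mem_closedBall_iff_norm] at this
    obtain ⟨z, -, hz⟩ := (isCompact_closedBall _ _).ultrafilter_le_nhds (U.map fun F => Z F t)
      (le_principal_iff.2 hev)
    exact ⟨z, hz⟩
  choose! z hz using hlim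
  refine ⟨z, mul_nonneg hΞ.const_nonneg (sewingConst_pos hθ).le, fun {s t} hst => ?_⟩
  have htend := ((hz t ⟨hst.1.trans hst.2.1, hst.2.2⟩).sub
    (hz s ⟨hst.1, hst.2.1.trans hst.2.2⟩)).const_sub (Ξ s t)
  refine le_of_tendsto htend.norm ?_
  filter_upwards [hU s t] with F hF
  rw [mul_assoc]
  exact hZ F s hF.1 t hF.2 hst

end Sewing

section DominatedAlgebra

variable {T θ θ₁ θ₂ C C₁ C₂ : ℝ} {ω : ℝ → ℝ → ℝ}

theorem IsDominated.add {E : Type*} [NormedAddCommGroup E] {A B : ℝ → ℝ → E}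
    (hA : IsDominated T ω θ C₁ A) (hB : IsDominated T ω θ C₂ B) :
    IsDominated T ω θ (C₁ + C₂) fun s t => A s t + B s t where
  const_nonneg := add_nonneg hA.const_nonneg hB.const_nonneg
  norm_le h := by
    rw [add_mul]
    exact norm_add_le_of_le (hA.norm_le h) (hB.norm_le h)

theorem IsDominated.sub {E : Type*} [NormedAddCommGroup E] {A B : ℝ → ℝ → E}
    (hA : IsDominated T ω θ C₁ A) (hB : IsDominated T ω θ C₂ B) :
    IsDominated T ω θ (C₁ + C₂) fun s t => A s t - B s t where
  const_nonneg := add_nonneg hA.const_nonneg hB.const_nonneg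
  norm_le h := by
    rw [add_mul]
    exact norm_sub_le_of_le (hA.norm_le h) (hB.norm_le h)

theorem IsDominated.list_sum {α E : Type*} [NormedAddCommGroup E] {A : α → ℝ → ℝ → E}
    {C : α → ℝ} {l : List α} (h : ∀ x ∈ l, IsDominated T ω θ (C x) (A x)) :
    IsDominated T ω θ (l.map C).sum fun s t => (l.map fun x => A x s t).sum := by
  induction l with
  | nil => exact ⟨le_rfl, by simp⟩
  | cons x l ih =>
    simp only [List.map_cons, List.sum_cons]
    exact (h x (by simp)).add (ih fun y hy => h y (by simp [hy]))

theorem IsDominated.mul {A B : ℝ → ℝ → ℝ} (hω : IsControl T ω) (hθ₁ : 0 ≤ θ₁) (hθ₂ : 0 ≤ θ₂)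
    (hA : IsDominated T ω θ₁ C₁ A) (hB : IsDominated T ω θ₂ C₂ B) :
    IsDominated T ω (θ₁ + θ₂) (C₁ * C₂) fun s t => A s t * B s t where
  const_nonneg := mul_nonneg hA.const_nonneg hB.const_nonneg
  norm_le {s t} h := by
    have hnonneg := hω.nonneg h
    have hC₁ := hA.const_nonneg
    calc ‖A s t * B s t‖ = ‖A s t‖ * ‖B s t‖ := norm_mul _ _
      _ ≤ (C₁ * ω s t ^ θ₁) * (C₂ * ω s t ^ θ₂) :=
          mul_le_mul (hA.norm_le h) (hB.norm_le h) (norm_nonneg _) (by positivity)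
      _ = C₁ * C₂ * ω s t ^ (θ₁ + θ₂) := by
          rw [Real.rpow_add_of_nonneg hnonneg hθ₁ hθ₂]
          ring

theorem IsDominated.mono_exponent {E : Type*} [NormedAddCommGroup E] {A : ℝ → ℝ → E}
    (hω : IsControl T ω) (hT : 0 ≤ T) (hθ₁ : 0 ≤ θ₁) (hθ : θ₁ ≤ θ)
    (hA : IsDominated T ω θ C A) : IsDominated T ω θ₁ (C * ω 0 T ^ (θ - θ₁)) A where
  const_nonneg :=
    mul_nonneg hA.const_nonneg (Real.rpow_nonneg (hω.nonneg ⟨le_rfl, hT, le_rfl⟩) _)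
  norm_le {s t} h := by
    have hC := hA.const_nonneg
    have hnonneg := hω.nonneg h
    calc ‖A s t‖ ≤ C * ω s t ^ θ := hA.norm_le h
      _ = C * (ω s t ^ (θ - θ₁) * ω s t ^ θ₁) := by
          rw [← Real.rpow_add_of_nonneg hnonneg (by linarith) hθ₁, sub_add_cancel]
      _ ≤ C * (ω 0 T ^ (θ - θ₁) * ω s t ^ θ₁) := by
          gcongr
          exact hω.mono le_rfl h.1 h.2.1 h.2.2 le_rfl
      _ = C * ω 0 T ^ (θ - θ₁) * ω s t ^ θ₁ := by ring

theorem IsDominated.initial {E : Type*} [NormedAddCommGroup E] {A : ℝ → ℝ → E}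
    (hω : IsControl T ω) (hT : 0 ≤ T) (hθ : 0 ≤ θ) (hA : IsDominated T ω θ C A) :
    IsDominated T ω 0 (C * ω 0 T ^ θ) fun s _ => A 0 s := by
  have hA' := hA.mono_exponent hω hT le_rfl hθ
  rw [sub_zero] at hA'
  exact ⟨hA'.const_nonneg, fun h => by
    simpa using hA'.norm_le ⟨le_rfl, h.1, h.2.1.trans h.2.2⟩⟩

end DominatedAlgebra

/-! ### The tensor product of tensor series -/

namespace TensorSeries

variable {ι : Type*}

/-- The left derivative of a tensor series along a letter. -/
def shift (x : ι) (a : TensorSeries ι) : TensorSeries ι := fun I => a (x :: I)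

/-- The part of the tensor product that comes from cutting a word into two non-empty words. -/
def mid (a b : TensorSeries ι) (I : List ι) : ℝ :=
  ∑ k ∈ Finset.Ico 1 I.length, a (I.take k) * b (I.drop k)

theorem length_take_lt {I : List ι} {k : ℕ} (hk : k ∈ Finset.Ico 1 I.length) :
    (I.take k).length < I.length := by
  rw [Finset.mem_Ico] at hk
  rw [List.length_take]
  omega

theorem length_drop_lt {I : List ι} {k : ℕ} (hk : k ∈ Finset.Ico 1 I.length) :
    (I.drop k).length < I.length := by
  rw [Finset.mem_Ico] at hk
  rw [List.length_drop]
  omega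

theorem tmul_nil (a b : TensorSeries ι) : tmul a b [] = a [] * b [] := by simp [tmul]

theorem tmul_cons (a b : TensorSeries ι) (x : ι) (I : List ι) :
    tmul a b (x :: I) = tmul (shift x a) b I + a [] * b (x :: I) := by
  simp [tmul, shift, Finset.sum_range_succ' _ (I.length + 1)]

theorem shift_tmul (a b : TensorSeries ι) (x : ι) :
    shift x (tmul a b) = fun J => tmul (shift x a) b J + a [] * shift x b J :=
  funext fun J => tmul_cons a b x J

theorem tmul_add_smul (c : ℝ) (a a' b : TensorSeries ι) (I : List ι) :
    tmul (fun J => a J + c * a' J) b I = tmul a b I + c * tmul a' b I := by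
  simp only [tmul, Finset.mul_sum, ← Finset.sum_add_distrib]
  exact Finset.sum_congr rfl fun k _ => by ring

theorem tmul_assoc (a b c : TensorSeries ι) : tmul (tmul a b) c = tmul a (tmul b c) := by
  funext I
  induction I generalizing a b with
  | nil => simp only [tmul_nil, mul_assoc]
  | cons x I ih =>
    rw [tmul_cons, tmul_cons a, shift_tmul, tmul_add_smul, ih, tmul_cons b, tmul_nil]
    ring

theorem tmul_eq_add_mid (a b : TensorSeries ι) {I : List ι} (hI : I ≠ []) :
    tmul a b I = a [] * b I + a I * b [] + mid a b I := by
  rw [tmul, mid, Finset.range_eq_Ico, Finset.sum_Ico_succ_top (Nat.zero_le _),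
    Finset.sum_eq_sum_Ico_succ_bot (List.length_pos_iff.2 hI), List.take_zero, List.drop_zero,
    List.take_length, List.drop_length]
  ring

theorem mid_congr {a a' b b' : TensorSeries ι} {I : List ι}
    (ha : ∀ J : List ι, J.length < I.length → a J = a' J)
    (hb : ∀ J : List ι, J.length < I.length → b J = b' J) : mid a b I = mid a' b' I :=
  Finset.sum_congr rfl fun _ hk => by rw [ha _ (length_take_lt hk), hb _ (length_drop_lt hk)]

theorem tmul_congr {a a' b b' : TensorSeries ι} {I : List ι}
    (ha : ∀ J : List ι, J.length ≤ I.length → a J = a' J)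
    (hb : ∀ J : List ι, J.length ≤ I.length → b J = b' J) : tmul a b I = tmul a' b' I :=
  Finset.sum_congr rfl fun k _ => by
    rw [ha _ (by rw [List.length_take]; omega), hb _ (by rw [List.length_drop]; omega)]

theorem mid_cocycle {a b c ab bc : TensorSeries ι} {I : List ι} (hI : I ≠ [])
    (ha : a [] = 1) (hb : b [] = 1) (hc : c [] = 1)
    (hab : ∀ J : List ι, J.length < I.length → ab J = tmul a b J)
    (hbc : ∀ J : List ι, J.length < I.length → bc J = tmul b c J) :
    mid a bc I - mid a b I - mid ab c I = - mid b c I := by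
  have h := congrFun (tmul_assoc a b c) I
  rw [tmul_eq_add_mid (tmul a b) _ hI, tmul_eq_add_mid a (tmul b c) hI, tmul_eq_add_mid a b hI,
    tmul_eq_add_mid b c hI, ← mid_congr hab (fun _ _ => rfl), ← mid_congr (fun _ _ => rfl) hbc,
    tmul_nil, tmul_nil, ha, hb, hc] at h
  linarith

end TensorSeries

open TensorSeries

/-! ### Weights and quasi-shuffles -/

section Weight

variable {ι : Type*}

/-- The weight of a word, for given weights of the letters. -/
def weight (w : ι → ℕ) (I : List ι) : ℕ := (I.map w).sum

@[simp] theorem weight_nil (w : ι → ℕ) : weight w [] = 0 := rfl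

@[simp] theorem weight_cons (w : ι → ℕ) (x : ι) (I : List ι) :
    weight w (x :: I) = w x + weight w I := by simp [weight]

theorem weight_append (w : ι → ℕ) (I J : List ι) :
    weight w (I ++ J) = weight w I + weight w J := by simp [weight]

theorem weight_take_add_drop (w : ι → ℕ) (I : List ι) (k : ℕ) :
    weight w (I.take k) + weight w (I.drop k) = weight w I := by
  rw [← weight_append, List.take_append_drop]

theorem weight_one (I : List ι) : weight (fun _ => 1) I = I.length := by
  simp [weight]

theorem weight_pos {w : ι → ℕ} (hw : ∀ x, 0 < w x) {I : List ι} (hI : I ≠ []) : 0 < weight w I := by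
  obtain ⟨x, J, rfl⟩ := List.exists_cons_of_ne_nil hI
  rw [weight_cons]
  exact Nat.add_pos_left (hw x) _

end Weight

section QuasiShuffle

variable {ι : Type*} (br : ι → ι → Option ι)

/-- The words, with multiplicity, of the quasi-shuffle product of two words, where `br` is a
partially defined product of letters: `br x y = none` stands for a vanishing product. -/
def quasiShuffle : List ι → List ι → List (List ι)
  | [], J => [J]
  | a :: I, [] => [a :: I]
  | a :: I, b :: J => (quasiShuffle I (b :: J)).map (a :: ·) ++
      (quasiShuffle (a :: I) J).map (b :: ·) ++
      (br a b).elim [] fun c => (quasiShuffle I J).map (c :: ·)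
  termination_by I J => I.length + J.length

/-- The evaluation of a tensor series on the quasi-shuffle product of two words. -/
def qeval (a : TensorSeries ι) (I J : List ι) : ℝ := ((quasiShuffle br I J).map a).sum

@[simp] theorem qeval_nil_left (a : TensorSeries ι) (J : List ι) : qeval br a [] J = a J := by
  simp [qeval, quasiShuffle]

@[simp] theorem qeval_nil_right (a : TensorSeries ι) (I : List ι) : qeval br a I [] = a I := by
  cases I <;> simp [qeval, quasiShuffle]

theorem qeval_cons_cons (a : TensorSeries ι) (x y : ι) (I J : List ι) :
    qeval br a (x :: I) (y :: J) = qeval br (shift x a) I (y :: J)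
      + qeval br (shift y a) (x :: I) J
      + (br x y).elim 0 fun c => qeval br (shift c a) I J := by
  cases h : br x y <;>
    simp [qeval, quasiShuffle, h, Function.comp_def, show ∀ z, shift z a = fun K => a (z :: K)
      from fun _ => rfl, add_assoc]

theorem qeval_add_smul (c : ℝ) (a b : TensorSeries ι) (I J : List ι) :
    qeval br (fun K => a K + c * b K) I J = qeval br a I J + c * qeval br b I J := by
  simp only [qeval, List.sum_map_add, List.sum_map_mul_left]

/-- Deconcatenation is a morphism for the quasi-shuffle product. -/
theorem qeval_tmul (a b : TensorSeries ι) (I J : List ι) :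
    qeval br (tmul a b) I J = ∑ i ∈ Finset.range (I.length + 1), ∑ j ∈ Finset.range (J.length + 1),
      qeval br a (I.take i) (J.take j) * qeval br b (I.drop i) (J.drop j) := by
  match I, J with
  | [], J => simp [tmul]
  | x :: I, [] => simp [tmul]
  | x :: I, y :: J =>
    have hprod : ((br x y).elim 0 fun c => qeval br (shift c (tmul a b)) I J)
        = (∑ i ∈ Finset.range (I.length + 1), ∑ j ∈ Finset.range (J.length + 1),
            ((br x y).elim 0 fun c => qeval br (shift c a) (I.take i) (J.take j))
              * qeval br b (I.drop i) (J.drop j))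
          + a [] * (br x y).elim 0 fun c => qeval br (shift c b) I J := by
      cases br x y with
      | none => simp
      | some c =>
        simp only [Option.elim_some]
        rw [shift_tmul, qeval_add_smul, qeval_tmul (shift c a) b I J]
    rw [qeval_cons_cons, hprod, shift_tmul, shift_tmul, qeval_add_smul, qeval_add_smul,
      qeval_tmul (shift x a) b I (y :: J), qeval_tmul (shift y a) b (x :: I) J]
    simp only [List.length_cons, Finset.sum_range_succ' _ (I.length + 1),
      Finset.sum_range_succ' _ (J.length + 1), List.take_succ_cons, List.drop_succ_cons,
      List.take_zero, List.drop_zero, qeval_nil_left, qeval_nil_right, qeval_cons_cons br a,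
      shift, add_mul, Finset.sum_add_distrib]
    rw [qeval_cons_cons br b x y I J]
    ring
  termination_by I.length + J.length

theorem weight_of_mem_quasiShuffle {w : ι → ℕ}
    (hw : ∀ x y c, br x y = some c → w c = w x + w y) (I J : List ι) :
    ∀ K ∈ quasiShuffle br I J, weight w K = weight w I + weight w J := by
  match I, J with
  | [], J => simp [quasiShuffle]
  | x :: I, [] => simp [quasiShuffle]
  | x :: I, y :: J =>
    intro K hK
    simp only [quasiShuffle, List.mem_append, List.mem_map] at hK
    rcases hK with (⟨K, hK, rfl⟩ | ⟨K, hK, rfl⟩) | hK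
    · have ih := weight_of_mem_quasiShuffle hw I (y :: J) K hK
      simp only [weight_cons] at ih ⊢
      omega
    · have ih := weight_of_mem_quasiShuffle hw (x :: I) J K hK
      simp only [weight_cons] at ih ⊢
      omega
    · cases h : br x y with
      | none => simp [h] at hK
      | some c =>
        simp only [h, Option.elim_some, List.mem_map] at hK
        obtain ⟨K, hK, rfl⟩ := hK
        have ih := weight_of_mem_quasiShuffle hw I J K hK
        have hc := hw x y c h
        simp only [weight_cons]
        omega
  termination_by I.length + J.length

end QuasiShuffle

/-! ### Multiplicative functionals -/

section Multiplicative

variable {ι : Type*} {T p : ℝ} {ω : ℝ → ℝ → ℝ} {w : ι → ℕ} {C : List ι → ℝ}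
  {S : ℝ → ℝ → TensorSeries ι} {I : List ι}

/-- Multiplicative functionals on `[0,T]` with values in `T((ℝ^ι))`. -/
structure IsMultiplicative (T : ℝ) (S : ℝ → ℝ → TensorSeries ι) : Prop where
  nil : ∀ {s t : ℝ}, (s, t) ∈ simplex T → S s t [] = 1
  chen : ∀ {s u t : ℝ}, 0 ≤ s → s ≤ u → u ≤ t → t ≤ T → S s t = tmul (S s u) (S u t)

theorem IsMultiplicative.sub_sub_eq_mid (hS : IsMultiplicative T S) {s u t : ℝ} (h0 : 0 ≤ s)
    (hsu : s ≤ u) (hut : u ≤ t) (hT : t ≤ T) (hI : I ≠ []) :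
    S s t I - S s u I - S u t I = mid (S s u) (S u t) I := by
  rw [hS.chen h0 hsu hut hT, tmul_eq_add_mid _ _ hI, hS.nil ⟨h0, hsu, hut.trans hT⟩,
    hS.nil ⟨h0.trans hsu, hut, hT⟩]
  ring

theorem IsMultiplicative.self_eq_zero (hS : IsMultiplicative T S) {s : ℝ} (h0 : 0 ≤ s)
    (hT : s ≤ T) (hI : I ≠ []) : S s s I = 0 := by
  induction hn : I.length using Nat.strong_induction_on generalizing I with
  | _ n ih =>
  have hmid : mid (S s s) (S s s) I = 0 := by
    refine Finset.sum_eq_zero fun k hk => ?_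
    rw [ih _ (hn ▸ length_take_lt hk) ?_ rfl, zero_mul]
    rw [Finset.mem_Ico] at hk
    exact List.length_pos_iff.1 (by rw [List.length_take]; omega)
  linarith [hS.sub_sub_eq_mid h0 le_rfl le_rfl hT hI]

theorem IsMultiplicative.eq_sum_add_sum_mid (hS : IsMultiplicative T S) {s t : ℝ}
    (hst : (s, t) ∈ simplex T) {N : ℕ} {u : ℕ → ℝ} (hu : IsPartition s t N u) (hI : I ≠ []) :
    S s t I = ∑ i ∈ Finset.range N, S (u i) (u (i + 1)) I
      + ∑ i ∈ Finset.range N, mid (S s (u i)) (S (u i) (u (i + 1))) I := by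
  suffices ∀ n ≤ N, S s (u n) I = ∑ i ∈ Finset.range n, S (u i) (u (i + 1)) I
      + ∑ i ∈ Finset.range n, mid (S s (u i)) (S (u i) (u (i + 1))) I by
    rw [← this N le_rfl, hu.2.1]
  intro n hn
  induction n with
  | zero => simp [hu.1, hS.self_eq_zero hst.1 (hst.2.1.trans hst.2.2) hI]
  | succ n ih =>
    have hmem := hu.mem_simplex hst hn
    have hsplit := hS.sub_sub_eq_mid hst.1 (hu.left_le (Nat.le_of_succ_le hn)) hmem.2.1 hmem.2.2 hI
    rw [Finset.sum_range_succ, Finset.sum_range_succ]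
    linarith [ih (by omega)]

theorem mid_nonneg {a b : TensorSeries ι} (ha : ∀ J : List ι, J.length < I.length → 0 ≤ a J)
    (hb : ∀ J : List ι, J.length < I.length → 0 ≤ b J) : 0 ≤ mid a b I :=
  Finset.sum_nonneg fun _ hk => mul_nonneg (ha _ (length_take_lt hk)) (hb _ (length_drop_lt hk))

theorem IsControl.abs_mid_le (hω : IsControl T ω) (hp : 0 ≤ p)
    (hC : ∀ J : List ι, J.length < I.length →
      IsDominated T ω (weight w J / p) (C J) fun s t => S s t J)
    {s u t : ℝ} (h0 : 0 ≤ s) (hsu : s ≤ u) (hut : u ≤ t) (hT : t ≤ T) :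
    |mid (S s u) (S u t) I| ≤ mid C C I * ω s t ^ (weight w I / p) := by
  have hle : ∀ {a b : ℝ}, s ≤ a → a ≤ b → b ≤ t → ∀ J : List ι, J.length < I.length →
      |S a b J| ≤ C J * ω s t ^ (weight w J / p) := by
    intro a b hsa hab hbt J hJ
    refine ((hC J hJ).norm_le ⟨h0.trans hsa, hab, hbt.trans hT⟩).trans ?_
    have hconst := (hC J hJ).const_nonneg
    gcongr
    · exact hω.nonneg ⟨h0.trans hsa, hab, hbt.trans hT⟩
    · exact hω.mono h0 hsa hab hbt hT
  have hnonneg : 0 ≤ ω s t := hω.nonneg ⟨h0, hsu.trans hut, hT⟩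
  rw [mid, mid, Finset.sum_mul]
  refine (Finset.abs_sum_le_sum_abs _ _).trans (Finset.sum_le_sum fun k hk => ?_)
  have hconst := (hC _ (length_take_lt hk)).const_nonneg
  calc |S s u (I.take k) * S u t (I.drop k)|
      = |S s u (I.take k)| * |S u t (I.drop k)| := abs_mul _ _
    _ ≤ (C (I.take k) * ω s t ^ (weight w (I.take k) / p))
        * (C (I.drop k) * ω s t ^ (weight w (I.drop k) / p)) :=
        mul_le_mul (hle le_rfl hsu hut _ (length_take_lt hk))
          (hle hsu hut le_rfl _ (length_drop_lt hk)) (abs_nonneg _) (by positivity)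
    _ = C (I.take k) * C (I.drop k) * ω s t ^ (weight w I / p) := by
        rw [← weight_take_add_drop w I k, Nat.cast_add, add_div,
          Real.rpow_add_of_nonneg hnonneg (by positivity) (by positivity)]
        ring

theorem IsMultiplicative.isAlmostAdditive (hS : IsMultiplicative T S) (hω : IsControl T ω)
    (hp : 0 ≤ p) (hI : I ≠ [])
    (hC : ∀ J : List ι, J.length < I.length →
      IsDominated T ω (weight w J / p) (C J) fun s t => S s t J) :
    IsAlmostAdditive T ω (weight w I / p) (mid C C I) fun s t => S s t I where
  const_nonneg := mid_nonneg (fun J hJ => (hC J hJ).const_nonneg) fun J hJ => (hC J hJ).const_nonneg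
  norm_sub_sub_le h0 hsu hut hT := by
    rw [hS.sub_sub_eq_mid h0 hsu hut hT hI]
    exact hω.abs_mid_le hp hC h0 hsu hut hT

theorem one_lt_natCast_div (hp0 : 0 < p) {n m : ℕ} (hp : p < n + 1) (hnm : n < m) :
    1 < (m : ℝ) / p := by
  rw [one_lt_div hp0]
  exact hp.trans_le (by exact_mod_cast hnm)

/-- The constant depends neither on the control nor on the multiplicative functional. -/
theorem exists_isDominated_weight (w : ι → ℕ) (hp0 : 0 < p) {n : ℕ} (hp : p < n + 1)
    {C₀ : List ι → ℝ} (I : List ι) :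
    ∃ C, ∀ (ω : ℝ → ℝ → ℝ) (S : ℝ → ℝ → TensorSeries ι), IsControl T ω → IsMultiplicative T S →
      (∀ J, weight w J ≤ n → IsDominated T ω (weight w J / p) (C₀ J) fun s t => S s t J) →
      (∀ J, n < weight w J → HasVanishingSums T fun s t => S s t J) →
      IsDominated T ω (weight w I / p) C fun s t => S s t I := by
  induction hn : I.length using Nat.strong_induction_on generalizing I with
  | _ k ih =>
  rcases Nat.lt_or_ge n (weight w I) with hlong | hshort
  · have hI : I ≠ [] := by
      rintro rfl
      exact absurd hlong (Nat.not_lt_zero n)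
    choose! C hC using fun (J : List ι) (hJ : J.length < I.length) => ih _ (hn ▸ hJ) J rfl
    refine ⟨mid C C I * sewingConst (weight w I / p), fun ω S hω hS hlow hsum => ?_⟩
    have hdefect := hS.isAlmostAdditive hω hp0.le hI fun J hJ => hC J hJ ω S hω hS hlow hsum
    exact hdefect.isDominated hω (one_lt_natCast_div hp0 hp hlong) (hsum I hlong)
  · exact ⟨C₀ I, fun ω S _ _ hlow _ => hlow I hshort⟩

end Multiplicative

section QuasiShuffleIdentity

variable {ι : Type*} {T p : ℝ} {ω : ℝ → ℝ → ℝ} {w : ι → ℕ} {C : List ι → ℝ}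
  {S : ℝ → ℝ → TensorSeries ι} {br : ι → ι → Option ι} {I J : List ι}

theorem IsMultiplicative.isAdditive_mul_sub_qeval (hS : IsMultiplicative T S) (hI : I ≠ [])
    (hshort : ∀ I' J' : List ι, I'.length + J'.length < I.length + J.length →
      ∀ {s t : ℝ}, (s, t) ∈ simplex T → S s t I' * S s t J' = qeval br (S s t) I' J') :
    IsAdditive T fun s t => S s t I * S s t J - qeval br (S s t) I J := by
  intro s u t h0 hsu hut hT
  have hsu' : (s, u) ∈ simplex T := ⟨h0, hsu, hut.trans hT⟩
  have hut' : (u, t) ∈ simplex T := ⟨h0.trans hsu, hut, hT⟩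
  have : 0 < I.length := List.length_pos_iff.2 hI
  have hterm : ∀ x ∈ Finset.range (I.length + 1) ×ˢ Finset.range (J.length + 1),
      x ≠ (I.length, J.length) ∧ x ≠ (0, 0) →
      S s u (I.take x.1) * S u t (I.drop x.1) * (S s u (J.take x.2) * S u t (J.drop x.2))
        - qeval br (S s u) (I.take x.1) (J.take x.2)
          * qeval br (S u t) (I.drop x.1) (J.drop x.2) = 0 := by
    rintro ⟨i, j⟩ hij ⟨hright, hleft⟩
    simp only [Finset.mem_product, Finset.mem_range, ne_eq, Prod.mk.injEq] at hij hright hleft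
    rw [← hshort _ _ (by simp only [List.length_take]; omega) hsu',
      ← hshort _ _ (by simp only [List.length_drop]; omega) hut']
    ring
  beta_reduce
  rw [hS.chen h0 hsu hut hT, qeval_tmul, tmul, tmul, Finset.sum_mul_sum,
    ← Finset.sum_product', ← Finset.sum_product', ← Finset.sum_sub_distrib,
    Finset.sum_eq_add (I.length, J.length) (0, 0) (by simp [hI]) hterm (by simp) (by simp)]
  simp [hS.nil hsu', hS.nil hut']

theorem IsControl.isDominated_mul_sub_qeval (hω : IsControl T ω) (hp : 0 ≤ p)
    (hC : ∀ I, IsDominated T ω (weight w I / p) (C I) fun s t => S s t I)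
    (hw : ∀ x y z, br x y = some z → w z = w x + w y) (I J : List ι) :
    IsDominated T ω ((weight w I + weight w J : ℕ) / p)
      (C I * C J + ((quasiShuffle br I J).map C).sum)
      fun s t => S s t I * S s t J - qeval br (S s t) I J := by
  have hprod := (hC I).mul hω (by positivity) (by positivity) (hC J)
  rw [← add_div, ← Nat.cast_add] at hprod
  refine hprod.sub (IsDominated.list_sum fun K hK => ?_)
  rw [← weight_of_mem_quasiShuffle br hw I J K hK]
  exact hC K

theorem IsMultiplicative.mul_eq_qeval (hS : IsMultiplicative T S) (hω : IsControl T ω)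
    (hp0 : 0 < p) {n : ℕ} (hp : p < n + 1)
    (hC : ∀ I, IsDominated T ω (weight w I / p) (C I) fun s t => S s t I)
    (hw : ∀ x y z, br x y = some z → w z = w x + w y)
    (hlow : ∀ I J : List ι, I ≠ [] → J ≠ [] → weight w I + weight w J ≤ n →
      ∀ {s t : ℝ}, (s, t) ∈ simplex T → S s t I * S s t J = qeval br (S s t) I J)
    (I J : List ι) {s t : ℝ} (hst : (s, t) ∈ simplex T) :
    S s t I * S s t J = qeval br (S s t) I J := by
  induction hm : I.length + J.length using Nat.strong_induction_on generalizing I J s t with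
  | _ m ih =>
  rcases eq_or_ne I [] with rfl | hI
  · rw [hS.nil hst, one_mul, qeval_nil_left]
  rcases eq_or_ne J [] with rfl | hJ
  · rw [hS.nil hst, mul_one, qeval_nil_right]
  rcases Nat.lt_or_ge n (weight w I + weight w J) with hlong | hshort
  · have hadd := hS.isAdditive_mul_sub_qeval (br := br) (J := J) hI
      fun I' J' hlen => fun {_ _} h => ih _ (hm ▸ hlen) I' J' h rfl
    have hsum := hω.hasVanishingSums (one_lt_natCast_div hp0 hp hlong)
      (hω.isDominated_mul_sub_qeval hp0.le hC hw I J)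
    exact sub_eq_zero.1 (hadd.eq_zero hsum hst)
  · exact hlow I J hI hJ hshort hst

end QuasiShuffleIdentity

/-! ### Regularity in time and integration against time -/

theorem IsDominated.continuousOn {E : Type*} [NormedAddCommGroup E] {T θ C : ℝ}
    {ω : ℝ → ℝ → ℝ} {f : ℝ → E} (hω : IsControl T ω) (hθ : 0 < θ)
    (hf : IsDominated T ω θ C (incr f)) : ContinuousOn f (Set.Icc 0 T) := by
  have hzero : Tendsto (fun x : ℝ => C * x ^ θ) (𝓝 0) (𝓝 0) := by
    have hcont : ContinuousAt (fun x : ℝ => C * x ^ θ) 0 :=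
      continuousAt_const.mul (Real.continuousAt_rpow_const _ _ (Or.inr hθ.le))
    simpa [ContinuousAt, Real.zero_rpow hθ.ne'] using hcont
  intro t ht
  have hright : ContinuousWithinAt f (Set.Icc t T) t := by
    rcases ht.2.eq_or_lt with rfl | htT
    · rw [Set.Icc_self]
      exact continuousWithinAt_singleton
    rw [continuousWithinAt_Icc_iff_Ici htT, ← continuousWithinAt_Ioi_iff_Ici]
    refine tendsto_iff_norm_sub_tendsto_zero.2 <| squeeze_zero' (.of_forall fun _ => norm_nonneg _)
      ?_ (hzero.comp (hω.tendsto_right t ⟨ht.1, htT⟩))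
    filter_upwards [Ioc_mem_nhdsGT htT] with v hv
    exact hf.norm_le ⟨ht.1, hv.1.le, hv.2⟩
  have hleft : ContinuousWithinAt f (Set.Icc 0 t) t := by
    rcases ht.1.eq_or_lt with rfl | h0t
    · rw [Set.Icc_self]
      exact continuousWithinAt_singleton
    rw [continuousWithinAt_Icc_iff_Iic h0t, ← continuousWithinAt_Iio_iff_Iic]
    refine tendsto_iff_norm_sub_tendsto_zero.2 <| squeeze_zero' (.of_forall fun _ => norm_nonneg _)
      ?_ (hzero.comp (hω.tendsto_left t ⟨h0t, ht.2⟩))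
    filter_upwards [Ico_mem_nhdsLT h0t] with u hu
    rw [norm_sub_rev]
    exact hf.norm_le ⟨hu.1, hu.2.le, ht.2⟩
  rw [← Set.Icc_union_Icc_eq_Icc ht.1 ht.2]
  exact hleft.union hright

theorem norm_integral_sub_smul_le {E : Type*} [NormedAddCommGroup E] [NormedSpace ℝ E]
    [CompleteSpace E] {f : ℝ → E} {u v M : ℝ} (huv : u ≤ v)
    (hf : IntervalIntegrable f MeasureTheory.volume u v)
    (hM : ∀ r ∈ Set.Icc u v, ‖f r - f u‖ ≤ M) :
    ‖(∫ r in u..v, f r) - (v - u) • f u‖ ≤ M * (v - u) := by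
  rw [← intervalIntegral.integral_const, ← intervalIntegral.integral_sub hf
    intervalIntegrable_const, ← abs_of_nonneg (sub_nonneg.2 huv)]
  refine intervalIntegral.norm_integral_le_of_norm_le_const fun r hr => hM r ?_
  rw [Set.uIoc_of_le huv] at hr
  exact Set.Ioc_subset_Icc_self hr

theorem IsDominated.integral_sub_smul {E : Type*} [NormedAddCommGroup E] [NormedSpace ℝ E]
    [CompleteSpace E] {T θ₁ θ₂ C₁ C₂ : ℝ} {ω : ℝ → ℝ → ℝ} {f : ℝ → E} (hω : IsControl T ω)
    (hθ₁ : 0 < θ₁) (hθ₂ : 0 ≤ θ₂) (hf : IsDominated T ω θ₁ C₁ (incr f))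
    (hlength : IsDominated T ω θ₂ C₂ fun u v => v - u) :
    IsDominated T ω (θ₁ + θ₂) (C₁ * C₂) fun u v => (∫ r in u..v, f r) - (v - u) • f u where
  const_nonneg := mul_nonneg hf.const_nonneg hlength.const_nonneg
  norm_le {u v} huv := by
    have hnonneg := hω.nonneg huv
    have hC₁ := hf.const_nonneg
    have hint : IntervalIntegrable f MeasureTheory.volume u v :=
      ((hf.continuousOn hω hθ₁).mono (Set.Icc_subset_Icc huv.1 huv.2.2)).intervalIntegrable_of_Icc
        huv.2.1
    have hosc : ∀ r ∈ Set.Icc u v, ‖f r - f u‖ ≤ C₁ * ω u v ^ θ₁ := by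
      intro r hr
      have hur : (u, r) ∈ simplex T := ⟨huv.1, hr.1, hr.2.trans huv.2.2⟩
      refine (hf.norm_le hur).trans ?_
      gcongr
      · exact hω.nonneg hur
      · exact hω.mono huv.1 le_rfl hr.1 hr.2 huv.2.2
    calc ‖(∫ r in u..v, f r) - (v - u) • f u‖ ≤ C₁ * ω u v ^ θ₁ * (v - u) :=
          norm_integral_sub_smul_le huv.2.1 hint hosc
      _ ≤ C₁ * ω u v ^ θ₁ * (C₂ * ω u v ^ θ₂) := by
          gcongr
          exact (Real.le_norm_self _).trans (hlength.norm_le huv)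
      _ = C₁ * C₂ * ω u v ^ (θ₁ + θ₂) := by
          rw [Real.rpow_add_of_nonneg hnonneg hθ₁.le hθ₂]
          ring

section TimeIntegration

variable {ι : Type*} {T p : ℝ} {ω : ℝ → ℝ → ℝ} {w : ι → ℕ} {C : List ι → ℝ}
  {S : ℝ → ℝ → TensorSeries ι}

theorem IsMultiplicative.incr_eq_sum (hS : IsMultiplicative T S) {u v : ℝ}
    (huv : (u, v) ∈ simplex T) (I : List ι) :
    incr (fun t => S 0 t I) u v
      = ∑ k ∈ Finset.range I.length, S 0 u (I.take k) * S u v (I.drop k) := by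
  rw [incr, hS.chen le_rfl huv.1 huv.2.1 huv.2.2, tmul, Finset.sum_range_succ]
  simp [hS.nil huv]

theorem IsControl.exists_isDominated_sum (hω : IsControl T ω) (hT : 0 ≤ T) (hp : 0 ≤ p)
    (hC : ∀ I, IsDominated T ω (weight w I / p) (C I) fun s t => S s t I) {m : ℕ}
    (a b : ℕ → List ι) (n : ℕ) (hm : ∀ k < n, m ≤ weight w (b k)) :
    ∃ D, IsDominated T ω (m / p) D
      fun u v => ∑ k ∈ Finset.range n, S 0 u (a k) * S u v (b k) := by
  induction n with
  | zero => exact ⟨0, le_rfl, by simp⟩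
  | succ n ih =>
    obtain ⟨D, hD⟩ := ih fun k hk => hm k (by omega)
    have hstart := (hC (a n)).initial hω hT (by positivity)
    have hincr := (hC (b n)).mono_exponent (θ₁ := m / p) hω hT (by positivity) <| by
      gcongr
      exact hm n n.lt_succ_self
    have hterm := hstart.mul hω le_rfl (by positivity) hincr
    rw [zero_add] at hterm
    simp only [Finset.sum_range_succ]
    exact ⟨_, hD.add hterm⟩

theorem IsMultiplicative.exists_isDominated_incr (hS : IsMultiplicative T S)
    (hω : IsControl T ω) (hT : 0 ≤ T) (hp : 0 ≤ p)
    (hC : ∀ I, IsDominated T ω (weight w I / p) (C I) fun s t => S s t I) (hw : ∀ x, 0 < w x)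
    (I : List ι) : ∃ D, IsDominated T ω (1 / p) D (incr fun t => S 0 t I) := by
  obtain ⟨D, hD⟩ := hω.exists_isDominated_sum (m := 1) hT hp hC I.take I.drop I.length
    fun k hk => weight_pos hw (by simpa using hk)
  refine ⟨D, hD.const_nonneg, fun huv => ?_⟩
  rw [hS.incr_eq_sum huv]
  simpa using hD.norm_le huv

theorem IsMultiplicative.continuousOn_zero (hS : IsMultiplicative T S) (hω : IsControl T ω)
    (hp : 0 < p) (hC : ∀ I, IsDominated T ω (weight w I / p) (C I) fun s t => S s t I)
    (hw : ∀ x, 0 < w x) (I : List ι) : ContinuousOn (fun t => S 0 t I) (Set.Icc 0 T) := by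
  rcases lt_or_ge T 0 with hT | hT
  · rw [Set.Icc_eq_empty hT.not_ge]
    exact continuousOn_empty _
  · obtain ⟨D, hD⟩ := hS.exists_isDominated_incr hω hT hp.le hC hw I
    exact hD.continuousOn hω (by positivity)

theorem IsMultiplicative.continuousOn_simplex (hS : IsMultiplicative T S)
    (hc : ∀ I, ContinuousOn (fun t => S 0 t I) (Set.Icc 0 T)) (I : List ι) :
    ContinuousOn (fun x : ℝ × ℝ => S x.1 x.2 I) (simplex T) := by
  induction hn : I.length using Nat.strong_induction_on generalizing I with
  | _ n ih =>
  rcases eq_or_ne I [] with rfl | hI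
  · exact continuousOn_const.congr fun x hx => hS.nil hx
  have hleft : ∀ J, ContinuousOn (fun x : ℝ × ℝ => S 0 x.1 J) (simplex T) := fun J =>
    (hc J).comp continuousOn_fst fun x hx => ⟨hx.1, hx.2.1.trans hx.2.2⟩
  have hright : ContinuousOn (fun x : ℝ × ℝ => S 0 x.2 I) (simplex T) :=
    (hc I).comp continuousOn_snd fun x hx => ⟨hx.1.trans hx.2.1, hx.2.2⟩
  have hmid : ContinuousOn (fun x : ℝ × ℝ => mid (S 0 x.1) (S x.1 x.2) I) (simplex T) :=
    continuousOn_finsetSum _ fun k hk => (hleft _).mul (ih _ (hn ▸ length_drop_lt hk) _ rfl)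
  refine ((hright.sub (hleft I)).sub hmid).congr fun x hx => ?_
  have hsplit := hS.sub_sub_eq_mid le_rfl hx.1 hx.2.1 hx.2.2 hI
  rw [Pi.sub_apply, Pi.sub_apply]
  linarith

theorem IsMultiplicative.incr_append_singleton (hS : IsMultiplicative T S) {u v : ℝ}
    (huv : (u, v) ∈ simplex T) (J : List ι) (x : ι) :
    incr (fun t => S 0 t (J ++ [x])) u v
      = ∑ k ∈ Finset.range J.length, S 0 u (J.take k) * S u v (J.drop k ++ [x])
        + S 0 u J * S u v [x] := by
  rw [hS.incr_eq_sum huv, List.length_append, List.length_singleton, Finset.sum_range_succ]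
  congr 1
  · refine Finset.sum_congr rfl fun k hk => ?_
    rw [Finset.mem_range] at hk
    rw [List.take_append_of_le_length hk.le, List.drop_append_of_le_length hk.le]
  · simp

theorem IsMultiplicative.exists_isDominated_sub_integral (hS : IsMultiplicative T S)
    (hω : IsControl T ω) (hT : 0 ≤ T) (hp : 0 < p)
    (hC : ∀ I, IsDominated T ω (weight w I / p) (C I) fun s t => S s t I) (hw : ∀ x, 0 < w x)
    {τ : ι} (hτ : ∀ {s t : ℝ}, (s, t) ∈ simplex T → S s t [τ] = t - s) (J : List ι) :
    ∃ D, IsDominated T ω ((w τ + 1 : ℕ) / p) D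
      fun u v => incr (fun t => S 0 t (J ++ [τ])) u v - ∫ r in u..v, S 0 r J := by
  obtain ⟨D₁, hD₁⟩ := hω.exists_isDominated_sum (m := w τ + 1) hT hp.le hC J.take
    (fun k => J.drop k ++ [τ]) J.length fun k hk => by
      have hpos : 0 < weight w (J.drop k) := weight_pos hw (by simpa using hk)
      rw [weight_append, weight_cons, weight_nil]
      omega
  obtain ⟨D₂, hD₂⟩ := hS.exists_isDominated_incr hω hT hp.le hC hw J
  have hlength : IsDominated T ω (w τ / p) (C [τ]) fun u v => v - u :=
    ⟨(hC [τ]).const_nonneg, fun huv => by simpa [hτ huv] using (hC [τ]).norm_le huv⟩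
  have hstep := hD₂.integral_sub_smul hω (by positivity) (by positivity) hlength
  rw [← add_div, add_comm, ← Nat.cast_add_one] at hstep
  refine ⟨D₁ + D₂ * C [τ], (hD₁.sub hstep).const_nonneg, fun {u v} huv => ?_⟩
  rw [hS.incr_append_singleton huv, hτ huv, mul_comm (S 0 u J), ← smul_eq_mul, add_sub_assoc,
    ← neg_sub, ← sub_eq_add_neg]
  exact (hD₁.sub hstep).norm_le huv

theorem IsMultiplicative.eq_integral (hS : IsMultiplicative T S) (hω : IsControl T ω)
    (hp0 : 0 < p) (hC : ∀ I, IsDominated T ω (weight w I / p) (C I) fun s t => S s t I)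
    (hw : ∀ x, 0 < w x) {τ : ι} (hp : p < w τ + 1)
    (hτ : ∀ {s t : ℝ}, (s, t) ∈ simplex T → S s t [τ] = t - s) (J : List ι) {t : ℝ}
    (ht : t ∈ Set.Icc 0 T) : S 0 t (J ++ [τ]) = ∫ r in (0 : ℝ)..t, S 0 r J := by
  have hT : 0 ≤ T := ht.1.trans ht.2
  have hint : ∀ {u v : ℝ}, (u, v) ∈ simplex T →
      IntervalIntegrable (fun r => S 0 r J) MeasureTheory.volume u v := fun {u v} huv =>
    ((hS.continuousOn_zero hω hp0 hC hw J).mono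
      (Set.Icc_subset_Icc huv.1 huv.2.2)).intervalIntegrable_of_Icc huv.2.1
  obtain ⟨D, hD⟩ := hS.exists_isDominated_sub_integral hω hT hp0 hC hw hτ J
  have hadd : IsAdditive T
      fun u v => incr (fun t => S 0 t (J ++ [τ])) u v - ∫ r in u..v, S 0 r J := by
    intro s u t h0 hsu hut hT
    beta_reduce
    rw [← intervalIntegral.integral_add_adjacent_intervals (hint ⟨h0, hsu, hut.trans hT⟩)
      (hint ⟨h0.trans hsu, hut, hT⟩), incr, incr, incr]
    ring
  have hzero := hadd.eq_zero (hω.hasVanishingSums (one_lt_natCast_div hp0 hp (w τ).lt_succ_self) hD)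
    ⟨le_rfl, ht.1, ht.2⟩
  rwa [incr, hS.self_eq_zero le_rfl hT (by simp), sub_zero, sub_eq_zero] at hzero

end TimeIntegration

/-! ### Functions determined by their iterated integrals -/

section IteratedIntegrals

open MeasureTheory

variable {a b : ℝ}

theorem hasDerivAt_of_eq_integral {f F : ℝ → ℝ} (hf : ContinuousOn f (Set.Icc a b))
    (hF : ∀ t ∈ Set.Icc a b, F t = ∫ r in a..t, f r) {x : ℝ} (hx : x ∈ Set.Ioo a b) :
    HasDerivAt F (f x) x := by
  have hnhds : Set.Icc a b ∈ 𝓝 x := Icc_mem_nhds hx.1 hx.2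
  refine HasDerivAt.congr_of_eventuallyEq ?_ (Filter.eventually_of_mem hnhds hF)
  exact intervalIntegral.integral_hasDerivAt_right
    ((hf.mono (Set.Icc_subset_Icc_right hx.2.le)).intervalIntegrable_of_Icc hx.1.le)
    ((hf.mono Set.Ioo_subset_Icc_self).stronglyMeasurableAtFilter isOpen_Ioo x hx)
    (hf.continuousAt hnhds)

/-- Integration by parts; the boundary terms vanish. -/
theorem integral_mul_pow_succ {f F : ℝ → ℝ} (hab : a ≤ b) (hf : ContinuousOn f (Set.Icc a b))
    (hFc : ContinuousOn F (Set.Icc a b)) (hF : ∀ t ∈ Set.Icc a b, F t = ∫ r in a..t, f r)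
    (hFb : F b = 0) (k : ℕ) :
    ∫ r in a..b, f r * (b - r) ^ (k + 1) = (k + 1) * ∫ r in a..b, F r * (b - r) ^ k := by
  have hpow : ∀ x : ℝ,
      HasDerivAt (fun r => (b - r) ^ (k + 1)) (-((k + 1 : ℕ) * (b - x) ^ k)) x := fun x => by
    simpa using ((hasDerivAt_id' x).const_sub b).fun_pow (k + 1)
  have hFa : F a = 0 := by rw [hF a ⟨le_rfl, hab⟩, intervalIntegral.integral_same]
  have hparts := intervalIntegral.integral_mul_deriv_eq_deriv_mul_of_hasDerivAt (a := a) (b := b)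
    (u := F) (v := fun r => (b - r) ^ (k + 1)) (by rwa [Set.uIcc_of_le hab]) (by fun_prop)
    (fun x hx => hasDerivAt_of_eq_integral hf hF (by
      rwa [min_eq_left hab, max_eq_right hab] at hx))
    (fun x _ => hpow x) (hf.intervalIntegrable_of_Icc hab)
    (Continuous.intervalIntegrable (by fun_prop) _ _)
  rw [hFa, hFb, zero_mul, zero_mul, sub_zero, zero_sub] at hparts
  rw [← intervalIntegral.integral_const_mul, ← neg_inj, ← hparts, ← intervalIntegral.integral_neg]
  exact intervalIntegral.integral_congr fun r _ => by push_cast; ring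

theorem integral_mul_pow_eq_zero {G : ℕ → ℝ → ℝ} (hab : a ≤ b)
    (hc : ∀ k, ContinuousOn (G k) (Set.Icc a b))
    (hG : ∀ k, ∀ t ∈ Set.Icc a b, G (k + 1) t = ∫ r in a..t, G k r) (hGb : ∀ k, G k b = 0)
    (k j : ℕ) : ∫ r in a..b, G j r * (b - r) ^ k = 0 := by
  induction k generalizing j with
  | zero => simpa only [pow_zero, mul_one, hGb] using (hG j b ⟨hab, le_rfl⟩).symm
  | succ k ih =>
    rw [integral_mul_pow_succ hab (hc j) (hc (j + 1)) (hG j) (hGb _), ih, mul_zero]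

theorem eq_zero_of_integral_mul_polynomial_eq_zero {f : ℝ → ℝ} (hab : a < b)
    (hf : ContinuousOn f (Set.Icc a b))
    (hpoly : ∀ q : Polynomial ℝ, ∫ r in a..b, f r * q.eval r = 0) {t : ℝ}
    (ht : t ∈ Set.Icc a b) : f t = 0 := by
  have hI : IntervalIntegrable f volume a b := hf.intervalIntegrable_of_Icc hab.le
  have hIf : IntervalIntegrable (fun r => f r * f r) volume a b :=
    (hf.mul hf).intervalIntegrable_of_Icc hab.le
  have hsq : ∫ r in a..b, f r * f r ≤ 0 := by
    set M := ∫ r in a..b, |f r|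
    have hM : 0 ≤ M := intervalIntegral.integral_nonneg hab.le fun _ _ => abs_nonneg _
    refine le_of_forall_pos_lt_add fun ε hε => ?_
    obtain ⟨q, hq⟩ := exists_polynomial_near_of_continuousOn a b f hf (ε / (M + 1)) (by positivity)
    have hIq : IntervalIntegrable (fun r => f r * q.eval r) volume a b :=
      hI.mul_continuousOn (by fun_prop)
    calc ∫ r in a..b, f r * f r = ∫ r in a..b, (f r * f r - f r * q.eval r) := by
          rw [intervalIntegral.integral_sub hIf hIq, hpoly q, sub_zero]
      _ ≤ ∫ r in a..b, ε / (M + 1) * |f r| := by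
          refine intervalIntegral.integral_mono_on hab.le (hIf.sub hIq) (hI.abs.const_mul _)
            fun r hr => ?_
          rw [← mul_sub, mul_comm (ε / (M + 1))]
          refine (le_abs_self _).trans ?_
          rw [abs_mul, abs_sub_comm]
          gcongr
          exact (hq r hr).le
      _ = ε / (M + 1) * M := intervalIntegral.integral_const_mul _ _
      _ < 0 + ε := by
          rw [div_mul_eq_mul_div, zero_add, div_lt_iff₀ (by linarith)]
          nlinarith
  by_contra hne
  have hpos := intervalIntegral.integral_pos hab (hf.mul hf) (fun x _ => mul_self_nonneg _)
    ⟨t, ht, mul_self_pos.2 hne⟩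
  exact hsq.not_gt hpos

theorem eq_zero_of_iterated_integrals_eq_zero {G : ℕ → ℝ → ℝ} (hab : a < b)
    (hc : ∀ k, ContinuousOn (G k) (Set.Icc a b))
    (hG : ∀ k, ∀ t ∈ Set.Icc a b, G (k + 1) t = ∫ r in a..t, G k r) (hGb : ∀ k, G k b = 0)
    {t : ℝ} (ht : t ∈ Set.Icc a b) : G 0 t = 0 := by
  refine eq_zero_of_integral_mul_polynomial_eq_zero hab (hc 0) (fun q => ?_) ht
  have hI : IntervalIntegrable (G 0) volume a b := (hc 0).intervalIntegrable_of_Icc hab.le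
  obtain ⟨q, rfl⟩ : ∃ q' : Polynomial ℝ, q = q'.comp (.C b - .X) :=
    ⟨q.comp (.C b - .X), by simp [Polynomial.comp_assoc]⟩
  simp only [Polynomial.eval_comp, Polynomial.eval_sub, Polynomial.eval_C, Polynomial.eval_X]
  simp only [Polynomial.eval_eq_sum_range, Finset.mul_sum]
  rw [intervalIntegral.integral_finsetSum fun i _ => hI.mul_continuousOn (by fun_prop)]
  refine Finset.sum_eq_zero fun i _ => ?_
  simp only [mul_left_comm (G 0 _)]
  rw [intervalIntegral.integral_const_mul, integral_mul_pow_eq_zero hab.le hc hG hGb i 0, mul_zero]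

end IteratedIntegrals

/-! ### The control given by the variation of a two-parameter function -/

section PowVar

variable {E : Type*} [NormedAddCommGroup E] {r : ℝ} {A : ℝ → ℝ → E} {s t : ℝ}

/-- The `r`-th power of the `r`-variation; unlike the variation itself, it is superadditive. -/
def powVar (r : ℝ) (A : ℝ → ℝ → E) (s t : ℝ) : ℝ≥0∞ :=
  ⨆ (N : ℕ) (u : ℕ → ℝ) (_ : IsPartition s t N u),
    ∑ i ∈ Finset.range N, ‖A (u i) (u (i + 1))‖ₑ ^ r

theorem rVar_eq_powVar_rpow (r : ℝ) (A : ℝ → ℝ → E) (s t : ℝ) :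
    rVar r A s t = powVar r A s t ^ (1 / r) := rfl

theorem powVar_eq_rVar_rpow (hr : 0 < r) (A : ℝ → ℝ → E) (s t : ℝ) :
    powVar r A s t = rVar r A s t ^ r := by
  rw [rVar_eq_powVar_rpow, ← ENNReal.rpow_mul, one_div_mul_cancel hr.ne', ENNReal.rpow_one]

theorem powVar_lt_top_iff (hr : 0 < r) : powVar r A s t < ∞ ↔ rVar r A s t < ∞ := by
  rw [powVar_eq_rVar_rpow hr, ENNReal.rpow_lt_top_iff_of_pos hr]

theorem sum_le_powVar (r : ℝ) (A : ℝ → ℝ → E) {N : ℕ} {u : ℕ → ℝ} (hu : IsPartition s t N u) :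
    ∑ i ∈ Finset.range N, ‖A (u i) (u (i + 1))‖ₑ ^ r ≤ powVar r A s t :=
  le_iSup_of_le N (le_iSup_of_le u (le_iSup_of_le hu le_rfl))

theorem exists_isPartition (h : s ≤ t) : ∃ x : ℕ × (ℕ → ℝ), IsPartition s t x.1 x.2 := by
  rcases h.eq_or_lt with rfl | h
  · exact ⟨(0, _), isPartition_refl s⟩
  · exact ⟨(1, _), isPartition_pair h⟩

theorem powVar_eq_biSup (r : ℝ) (A : ℝ → ℝ → E) (s t : ℝ) :
    powVar r A s t = ⨆ (x : ℕ × (ℕ → ℝ)) (_ : IsPartition s t x.1 x.2),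
      ∑ i ∈ Finset.range x.1, ‖A (x.2 i) (x.2 (i + 1))‖ₑ ^ r := by
  rw [iSup_prod]; rfl

theorem powVar_add_le (r : ℝ) (A : ℝ → ℝ → E) {u : ℝ} (hsu : s ≤ u) (hut : u ≤ t) :
    powVar r A s u + powVar r A u t ≤ powVar r A s t := by
  rw [powVar_eq_biSup r A s u, powVar_eq_biSup r A u t]
  refine ENNReal.biSup_add_biSup_le' (exists_isPartition hsu) (exists_isPartition hut)
    fun x hx y hy => ?_
  rw [← sum_concat (hx.2.1.trans hy.1.symm) fun a b => ‖A a b‖ₑ ^ r]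
  exact sum_le_powVar r A (hx.concat hy)

theorem powVar_mono (r : ℝ) (A : ℝ → ℝ → E) {s' t' : ℝ} (hs : s ≤ s') (hst : s' ≤ t')
    (ht : t' ≤ t) : powVar r A s' t' ≤ powVar r A s t :=
  calc powVar r A s' t' ≤ powVar r A s s' + powVar r A s' t' := le_add_self
    _ ≤ powVar r A s t' := powVar_add_le r A hs hst
    _ ≤ powVar r A s t' + powVar r A t' t := le_self_add
    _ ≤ powVar r A s t := powVar_add_le r A (hs.trans hst) ht

theorem rVar_mono (hr : 0 < r) (A : ℝ → ℝ → E) {s' t' : ℝ} (hs : s ≤ s') (hst : s' ≤ t')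
    (ht : t' ≤ t) : rVar r A s' t' ≤ rVar r A s t :=
  ENNReal.rpow_le_rpow (powVar_mono r A hs hst ht) (by positivity)

theorem enorm_le_rVar (hr : 0 < r) (A : ℝ → ℝ → E) (h : s < t) : ‖A s t‖ₑ ≤ rVar r A s t := by
  rw [rVar_eq_powVar_rpow, one_div, ENNReal.le_rpow_inv_iff hr]
  simpa using sum_le_powVar r A (isPartition_pair h)

theorem rVar_le_of_norm_le {F : Type*} [NormedAddCommGroup F] {B : ℝ → ℝ → F} (hr : 0 < r)
    (h : ∀ u v, ‖A u v‖ ≤ ‖B u v‖) (s t : ℝ) : rVar r A s t ≤ rVar r B s t := by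
  refine ENNReal.rpow_le_rpow (iSup_mono fun N => iSup_mono fun u => iSup_mono fun _ =>
    Finset.sum_le_sum fun i _ => ENNReal.rpow_le_rpow ?_ hr.le) (by positivity)
  exact enorm_le_iff_norm_le.2 (h _ _)

theorem IsPartition.reverse {N : ℕ} {u : ℕ → ℝ} (hu : IsPartition s t N u) (T : ℝ) :
    IsPartition (T - t) (T - s) N fun i => T - u (N - i) := by
  refine ⟨by simp [hu.2.1], by simp [hu.1], fun i hi => ?_⟩
  have hlt := hu.2.2 (N - (i + 1)) (by omega)
  rw [show N - (i + 1) + 1 = N - i by omega] at hlt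
  exact sub_lt_sub_left hlt T

theorem powVar_reverse (r : ℝ) (A : ℝ → ℝ → E) (T s t : ℝ) :
    powVar r (fun u v => A (T - v) (T - u)) s t = powVar r A (T - t) (T - s) := by
  have hle : ∀ (B : ℝ → ℝ → E) (s t : ℝ),
      powVar r (fun u v => B (T - v) (T - u)) s t ≤ powVar r B (T - t) (T - s) := by
    refine fun B s t => iSup_le fun N => iSup_le fun u => iSup_le fun hu => ?_
    refine le_of_eq_of_le ?_ (sum_le_powVar r B (hu.reverse T))
    rw [← Finset.sum_range_reflect]
    refine Finset.sum_congr rfl fun i hi => ?_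
    rw [Finset.mem_range] at hi
    rw [show N - 1 - i + 1 = N - i by omega, show N - 1 - i = N - (i + 1) by omega]
  refine (hle A s t).antisymm ?_
  simpa using hle (fun u v => A (T - v) (T - u)) (T - t) (T - s)

variable {T : ℝ}

/-- The variation is a supremum of sums which are continuous in the first time of the partition. -/
theorem eventually_lt_powVar (hA : ContinuousOn (fun x : ℝ × ℝ => A x.1 x.2) (simplex T)) {m : ℝ}
    (h0 : 0 ≤ m) (hmt : m < t) (hT : t ≤ T) {c : ℝ≥0∞} (hc : c < powVar r A m t) :
    ∀ᶠ v in 𝓝[>] m, c < powVar r A v t := by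
  simp only [powVar, lt_iSup_iff] at hc
  obtain ⟨N, u, hu, hlt⟩ := hc
  obtain ⟨M, rfl⟩ : ∃ M, N = M + 1 := by
    refine Nat.exists_eq_succ_of_ne_zero ?_
    rintro rfl
    exact hmt.ne (hu.1.symm.trans hu.2.1)
  have hm1 : m < u 1 := hu.1 ▸ hu.2.2 0 (Nat.succ_pos M)
  have h1T : u 1 ≤ T := (hu.le_right (Nat.le_add_left 1 M)).trans hT
  rw [Finset.sum_range_succ', zero_add, hu.1] at hlt
  have hpair : Tendsto (fun v : ℝ => (v, u 1)) (𝓝[>] m) (𝓝[simplex T] (m, u 1)) := by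
    refine tendsto_nhdsWithin_iff.2 ⟨?_, ?_⟩
    · exact ((continuous_id.prodMk continuous_const).tendsto m).mono_left nhdsWithin_le_nhds
    · filter_upwards [Ioo_mem_nhdsGT hm1] with v hv
      exact ⟨h0.trans hv.1.le, hv.2.le, h1T⟩
  have hfirst : Tendsto (fun v => ‖A v (u 1)‖ₑ ^ r) (𝓝[>] m) (𝓝 (‖A m (u 1)‖ₑ ^ r)) :=
    ((ENNReal.continuous_rpow_const.comp continuous_enorm).tendsto _).comp
      ((hA _ ⟨h0, hm1.le, h1T⟩).tendsto.comp hpair)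
  filter_upwards [(tendsto_const_nhds.add hfirst).eventually_const_lt hlt, Ioo_mem_nhdsGT hm1]
    with v hv hvm
  have hpart : IsPartition v t (M + 1) (Function.update u 0 v) := by
    refine ⟨by simp, by simp [hu.2.1], fun i hi => ?_⟩
    rcases Nat.eq_zero_or_pos i with rfl | hi0
    · simpa using hvm.2
    · rw [Function.update_of_ne hi0.ne', Function.update_of_ne (by omega)]
      exact hu.2.2 i hi
  refine hv.trans_le ?_
  simpa [Finset.sum_range_succ'] using sum_le_powVar r A hpart

theorem tendsto_powVar_right (hA : ContinuousOn (fun x : ℝ × ℝ => A x.1 x.2) (simplex T)) {m : ℝ}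
    (hm : m ∈ Set.Ico 0 T) (hfin : powVar r A m T ≠ ∞) :
    Tendsto (powVar r A m) (𝓝[>] m) (𝓝 0) := by
  refine ENNReal.tendsto_nhds_zero.2 fun ε hε => ?_
  rcases eq_or_ne (powVar r A m T) 0 with hzero | hne
  · filter_upwards [Ioo_mem_nhdsGT hm.2] with v hv
    exact (powVar_mono r A le_rfl hv.1.le hv.2.le).trans (hzero.trans_le zero_le)
  · filter_upwards [Ioo_mem_nhdsGT hm.2,
      eventually_lt_powVar hA hm.1 hm.2 le_rfl (ENNReal.sub_lt_self hfin hne hε.ne')] with v hv hlt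
    have hvT : powVar r A v T ≠ ∞ :=
      ne_top_of_le_ne_top hfin (powVar_mono r A hv.1.le hv.2.le le_rfl)
    refine (ENNReal.add_le_add_iff_right hvT).1 ?_
    exact (powVar_add_le r A hv.1.le hv.2.le).trans (tsub_le_iff_left.1 hlt.le)

theorem continuousOn_reverse (hA : ContinuousOn (fun x : ℝ × ℝ => A x.1 x.2) (simplex T)) :
    ContinuousOn (fun x : ℝ × ℝ => A (T - x.2) (T - x.1)) (simplex T) := by
  refine hA.comp (f := fun x : ℝ × ℝ => (T - x.2, T - x.1)) (by fun_prop) fun x hx => ?_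
  exact ⟨sub_nonneg.2 hx.2.2, sub_le_sub_left hx.2.1 T, sub_le_self T hx.1⟩

theorem tendsto_powVar_left (hA : ContinuousOn (fun x : ℝ × ℝ => A x.1 x.2) (simplex T)) {m : ℝ}
    (hm : m ∈ Set.Ioc 0 T) (hfin : powVar r A 0 m ≠ ∞) :
    Tendsto (fun s => powVar r A s m) (𝓝[<] m) (𝓝 0) := by
  have hrev : ∀ s, powVar r A s m
      = powVar r (fun u v => A (T - v) (T - u)) (T - m) (T - s) := fun s => by
    rw [powVar_reverse, sub_sub_cancel, sub_sub_cancel]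
  have hreflect : Tendsto (fun s => T - s) (𝓝[<] m) (𝓝[>] (T - m)) := by
    refine tendsto_nhdsWithin_iff.2 ⟨?_, ?_⟩
    · exact ((continuous_const.sub continuous_id).tendsto m).mono_left nhdsWithin_le_nhds
    · filter_upwards [self_mem_nhdsWithin] with s hs using sub_lt_sub_left hs T
  simp only [hrev]
  refine (tendsto_powVar_right (continuousOn_reverse hA)
    ⟨sub_nonneg.2 hm.2, sub_lt_self T hm.1⟩ ?_).comp hreflect
  simpa [powVar_reverse] using hfin

theorem isControl_powVar (hA : ContinuousOn (fun x : ℝ × ℝ => A x.1 x.2) (simplex T))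
    (hfin : powVar r A 0 T < ∞) : IsControl T fun s t => (powVar r A s t).toReal := by
  have hne : ∀ {s t : ℝ}, 0 ≤ s → s ≤ t → t ≤ T → powVar r A s t ≠ ∞ := fun h0 hst hT =>
    ((powVar_mono r A h0 hst hT).trans_lt hfin).ne
  refine ⟨fun _ => ENNReal.toReal_nonneg, fun h0 hsu hut hT => ?_, fun m hm => ?_, fun m hm => ?_⟩
  · rw [← ENNReal.toReal_add (hne h0 hsu (hut.trans hT)) (hne (h0.trans hsu) hut hT)]
    exact ENNReal.toReal_mono (hne h0 (hsu.trans hut) hT) (powVar_add_le r A hsu hut)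
  · exact (ENNReal.tendsto_toReal ENNReal.zero_ne_top).comp
      (tendsto_powVar_right hA hm (hne hm.1 hm.2.le le_rfl))
  · exact (ENNReal.tendsto_toReal ENNReal.zero_ne_top).comp
      (tendsto_powVar_left hA hm (hne le_rfl hm.1.le hm.2))

theorem norm_le_powVar_rpow (hr : 0 < r) (hfin : powVar r A 0 T < ∞) (hst : (s, t) ∈ simplex T)
    (hself : A s s = 0) : ‖A s t‖ ≤ (powVar r A s t).toReal ^ (1 / r) := by
  rcases hst.2.1.eq_or_lt with heq | hlt
  · obtain rfl : s = t := heq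
    rw [hself, norm_zero]
    positivity
  have hne : rVar r A s t ≠ ∞ := ENNReal.rpow_ne_top_of_nonneg (by positivity)
    ((powVar_mono r A hst.1 hst.2.1 hst.2.2).trans_lt hfin).ne
  have hle := ENNReal.toReal_mono hne (enorm_le_rVar hr A hlt)
  rwa [toReal_enorm, rVar_eq_powVar_rpow, ← ENNReal.toReal_rpow] at hle

theorem hasVanishingSums_of_rVar_lt_top (hr : 0 < r) (hr1 : r < 1)
    (hA : ContinuousOn (fun x : ℝ × ℝ => A x.1 x.2) (simplex T)) (hfin : rVar r A 0 T < ∞)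
    (hself : ∀ s ∈ Set.Icc 0 T, A s s = 0) : HasVanishingSums T A := by
  rw [← powVar_lt_top_iff hr] at hfin
  refine (isControl_powVar hA hfin).hasVanishingSums (θ := 1 / r) (C := 1)
    (by rwa [one_lt_div hr]) ⟨zero_le_one, fun hst => ?_⟩
  rw [one_mul]
  exact norm_le_powVar_rpow hr hfin hst (hself _ ⟨hst.1, hst.2.1.trans hst.2.2⟩)

theorem IsDominated.enorm_rpow_le {ω : ℝ → ℝ → ℝ} {C : ℝ} (hr : 0 < r) (hω : IsControl T ω)
    (hA : IsDominated T ω (1 / r) C A) (hst : (s, t) ∈ simplex T) :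
    ‖A s t‖ₑ ^ r ≤ ENNReal.ofReal (C ^ r * ω s t) := by
  have hnonneg := hω.nonneg hst
  rw [← ofReal_norm, ENNReal.ofReal_rpow_of_nonneg (norm_nonneg _) hr.le]
  refine ENNReal.ofReal_le_ofReal
    ((Real.rpow_le_rpow (norm_nonneg _) (hA.norm_le hst) hr.le).trans_eq ?_)
  rw [Real.mul_rpow hA.const_nonneg (by positivity), ← Real.rpow_mul hnonneg,
    one_div_mul_cancel hr.ne', Real.rpow_one]

theorem IsDominated.rVar_lt_top {ω : ℝ → ℝ → ℝ} {C : ℝ} (hr : 0 < r) (hω : IsControl T ω)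
    (hA : IsDominated T ω (1 / r) C A) : rVar r A 0 T < ∞ := by
  rw [← powVar_lt_top_iff hr]
  refine lt_of_le_of_lt ?_ (ENNReal.ofReal_lt_top (r := C ^ r * ω 0 T))
  refine iSup_le fun N => iSup_le fun u => iSup_le fun hu => ?_
  have h0T : ((0 : ℝ), T) ∈ simplex T := ⟨le_rfl, hu.1 ▸ hu.le_right N.zero_le, le_rfl⟩
  have hmem : ∀ i ∈ Finset.range N, (u i, u (i + 1)) ∈ simplex T := fun i hi =>
    hu.mem_simplex h0T (Finset.mem_range.1 hi)
  have hCr : 0 ≤ C ^ r := Real.rpow_nonneg hA.const_nonneg r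
  calc ∑ i ∈ Finset.range N, ‖A (u i) (u (i + 1))‖ₑ ^ r
      ≤ ∑ i ∈ Finset.range N, ENNReal.ofReal (C ^ r * ω (u i) (u (i + 1))) :=
        Finset.sum_le_sum fun i hi => hA.enorm_rpow_le hr hω (hmem i hi)
    _ = ENNReal.ofReal (C ^ r * ∑ i ∈ Finset.range N, ω (u i) (u (i + 1))) := by
        rw [Finset.mul_sum, ENNReal.ofReal_sum_of_nonneg fun i hi =>
          mul_nonneg hCr (hω.nonneg (hmem i hi))]
    _ ≤ ENNReal.ofReal (C ^ r * ω 0 T) := by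
        gcongr
        exact hω.sum_le h0T hu

end PowVar

/-! ### Rough paths -/

section VariationContinuity

variable {M E : Type*} [PseudoEMetricSpace M] [NormedAddCommGroup E] {A : M → ℝ → ℝ → E}
  {r s t T : ℝ}

theorem continuous_toReal_powVar (hr : 1 ≤ r)
    (hA : ∀ x y, rVar r (fun s t => A x s t - A y s t) 0 T ≤ edist x y)
    (hfin : ∀ x, powVar r (A x) 0 T < ∞) (hst : (s, t) ∈ simplex T) :
    Continuous fun x => (powVar r (A x) s t).toReal := by
  have hr0 : 0 < r := by linarith
  have hrVar : Continuous fun x => rVar r (A x) s t := by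
    refine continuous_of_le_add_edist 1 ENNReal.one_ne_top fun x y => ?_
    calc rVar r (A x) s t = rVar r (fun a b => A y a b + (A x a b - A y a b)) s t := by
          simp only [add_sub_cancel]
      _ ≤ rVar r (A y) s t + rVar r (fun a b => A x a b - A y a b) s t := rVar_add_le hr _ _ _ _
      _ ≤ rVar r (A y) s t + 1 * edist x y := by
          rw [one_mul]
          gcongr
          exact (rVar_mono hr0 _ hst.1 hst.2.1 hst.2.2).trans (hA x y)
  have hpow : Continuous fun x => powVar r (A x) s t := by
    simp only [powVar_eq_rVar_rpow hr0]
    exact ENNReal.continuous_rpow_const.comp hrVar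
  refine continuous_iff_continuousAt.2 fun x => ?_
  exact (ENNReal.tendsto_toReal ((powVar_mono r _ hst.1 hst.2.1 hst.2.2).trans_lt (hfin x)).ne).comp
    hpow.continuousAt

theorem continuous_of_rVar_sub_le_edist (hr : 0 < r)
    (hA : ∀ x y, rVar r (fun s t => A x s t - A y s t) 0 T ≤ edist x y)
    (hself : ∀ x, ∀ s ∈ Set.Icc 0 T, A x s s = 0) (hst : (s, t) ∈ simplex T) :
    Continuous fun x => A x s t := by
  rcases hst.2.1.eq_or_lt with heq | hlt
  · obtain rfl : s = t := heq
    simpa only [hself _ s ⟨hst.1, hst.2.2⟩] using continuous_const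
  · refine (LipschitzWith.of_edist_le fun x y => ?_).continuous
    rw [edist_eq_enorm_sub]
    calc ‖A x s t - A y s t‖ₑ ≤ rVar r (fun s t => A x s t - A y s t) s t :=
          enorm_le_rVar hr (fun s t => A x s t - A y s t) hlt
      _ ≤ rVar r (fun s t => A x s t - A y s t) 0 T := rVar_mono hr _ hst.1 hst.2.1 hst.2.2
      _ ≤ edist x y := hA x y

end VariationContinuity

theorem continuousOn_incr {E : Type*} [NormedAddCommGroup E] {T : ℝ} {f : ℝ → E}
    (hf : ContinuousOn f (Set.Icc 0 T)) :
    ContinuousOn (fun x : ℝ × ℝ => incr f x.1 x.2) (simplex T) :=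
  (hf.comp continuousOn_snd fun _ hx => ⟨hx.1.trans hx.2.1, hx.2.2⟩).sub
    (hf.comp continuousOn_fst fun _ hx => ⟨hx.1, hx.2.1.trans hx.2.2⟩)

namespace RoughPath

variable {p T : ℝ} {ι : Type*} [Fintype ι] {s t : ℝ}

theorem pos (X : RoughPath p T ι) : 0 < p := two_pos.trans_le X.two_le

/-- The control `‖X‖_{p;[s,t]}^p + ‖𝕏‖_{p/2;[s,t]}^{p/2}` of a rough path. -/
def control (X : RoughPath p T ι) (s t : ℝ) : ℝ :=
  (powVar p (incr X.path) s t).toReal + (powVar (p / 2) X.lift s t).toReal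

theorem lift_self (X : RoughPath p T ι) (hs : s ∈ Set.Icc 0 T) : X.lift s s = 0 := by
  ext ⟨i, j⟩
  have hchen := X.chen s s s hs.1 le_rfl le_rfl hs.2 i j
  simp only [incr, sub_self, PiLp.zero_apply, mul_zero, add_zero] at hchen ⊢
  linarith

theorem powVar_path_lt_top (X : RoughPath p T ι) : powVar p (incr X.path) 0 T < ∞ :=
  (powVar_lt_top_iff X.pos).2 X.path_rVar

theorem powVar_lift_lt_top (X : RoughPath p T ι) : powVar (p / 2) X.lift 0 T < ∞ :=
  (powVar_lt_top_iff (half_pos X.pos)).2 X.lift_rVar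

theorem isControl_control (X : RoughPath p T ι) : IsControl T X.control :=
  (isControl_powVar (continuousOn_incr X.path_continuousOn) X.powVar_path_lt_top).add
    (isControl_powVar X.lift_continuousOn X.powVar_lift_lt_top)

theorem isDominated_incr (X : RoughPath p T ι) (i : ι) :
    IsDominated T X.control (1 / p) 1 fun s t => incr X.path s t i where
  const_nonneg := zero_le_one
  norm_le {s t} hst := by
    have hp := X.pos
    calc ‖incr X.path s t i‖ ≤ ‖incr X.path s t‖ := PiLp.norm_apply_le _ i
      _ ≤ (powVar p (incr X.path) s t).toReal ^ (1 / p) :=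
        norm_le_powVar_rpow hp X.powVar_path_lt_top hst (sub_self _)
      _ ≤ X.control s t ^ (1 / p) := by
        gcongr
        exact le_add_of_nonneg_right ENNReal.toReal_nonneg
      _ = 1 * X.control s t ^ (1 / p) := (one_mul _).symm

theorem isDominated_lift (X : RoughPath p T ι) (i j : ι) :
    IsDominated T X.control (2 / p) 1 fun s t => X.lift s t (i, j) where
  const_nonneg := zero_le_one
  norm_le {s t} hst := by
    have hp := X.pos
    calc ‖X.lift s t (i, j)‖ ≤ ‖X.lift s t‖ := PiLp.norm_apply_le _ (i, j)
      _ ≤ (powVar (p / 2) X.lift s t).toReal ^ (1 / (p / 2)) :=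
        norm_le_powVar_rpow (half_pos hp) X.powVar_lift_lt_top hst
          (X.lift_self ⟨hst.1, hst.2.1.trans hst.2.2⟩)
      _ ≤ X.control s t ^ (2 / p) := by
        rw [one_div_div]
        gcongr
        exact le_add_of_nonneg_left ENNReal.toReal_nonneg
      _ = 1 * X.control s t ^ (2 / p) := (one_mul _).symm

theorem rVar_incr_sub_le_edist (X Y : RoughPath p T ι) :
    rVar p (fun s t => incr X.path s t - incr Y.path s t) 0 T ≤ edist X Y := le_self_add

theorem rVar_lift_sub_le_edist (X Y : RoughPath p T ι) :
    rVar (p / 2) (fun s t => X.lift s t - Y.lift s t) 0 T ≤ edist X Y := le_add_self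

theorem continuous_control (hst : (s, t) ∈ simplex T) :
    Continuous fun X : RoughPath p T ι => X.control s t := by
  refine continuous_iff_continuousAt.2 fun X => Continuous.continuousAt (.add ?_ ?_)
  · exact continuous_toReal_powVar (by linarith [X.two_le]) rVar_incr_sub_le_edist
      powVar_path_lt_top hst
  · exact continuous_toReal_powVar (by linarith [X.two_le]) rVar_lift_sub_le_edist
      powVar_lift_lt_top hst

theorem continuous_incr (hst : (s, t) ∈ simplex T) (i : ι) :
    Continuous fun X : RoughPath p T ι => incr X.path s t i := by
  refine (PiLp.continuous_apply 2 _ i).comp (continuous_iff_continuousAt.2 fun X => ?_)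
  exact (continuous_of_rVar_sub_le_edist X.pos rVar_incr_sub_le_edist
    (fun _ _ _ => sub_self _) hst).continuousAt

theorem continuous_lift (hst : (s, t) ∈ simplex T) (i j : ι) :
    Continuous fun X : RoughPath p T ι => X.lift s t (i, j) := by
  refine (PiLp.continuous_apply 2 _ (i, j)).comp (continuous_iff_continuousAt.2 fun X => ?_)
  exact (continuous_of_rVar_sub_le_edist (half_pos X.pos) rVar_lift_sub_le_edist
    (fun Y _ hs => Y.lift_self hs) hst).continuousAt

end RoughPath

/-! ### Extension of multiplicative functionals -/

section Extension

variable {ι : Type*} {T p : ℝ} {ω : ℝ → ℝ → ℝ} {n : ℕ} {S : ℝ → ℝ → TensorSeries ι} {I : List ι}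

/-- Multiplicative functionals of finite `p`-variation which are truncated at level `n`: nothing is
required of the words of length greater than `n`. -/
structure IsPartialExtension (T p : ℝ) (ω : ℝ → ℝ → ℝ) (n : ℕ) (S : ℝ → ℝ → TensorSeries ι) :
    Prop where
  nil : ∀ {s t : ℝ}, (s, t) ∈ simplex T → S s t [] = 1
  chen : ∀ {s u t : ℝ}, 0 ≤ s → s ≤ u → u ≤ t → t ≤ T → ∀ I : List ι, I.length ≤ n →
    S s t I = tmul (S s u) (S u t) I
  bound : ∀ I : List ι, I.length ≤ n → ∃ C, IsDominated T ω (I.length / p) C fun s t => S s t I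

namespace IsPartialExtension

theorem mid_sub_sub_mid (hS : IsPartialExtension T p ω n S) (hI : I.length = n + 1) {s u t : ℝ}
    (h0 : 0 ≤ s) (hsu : s ≤ u) (hut : u ≤ t) (hT : t ≤ T) :
    mid (S 0 s) (S s t) I - mid (S 0 s) (S s u) I - mid (S 0 u) (S u t) I
      = - mid (S s u) (S u t) I :=
  mid_cocycle (List.length_pos_iff.1 (by omega)) (hS.nil ⟨le_rfl, h0, by linarith⟩)
    (hS.nil ⟨h0, hsu, hut.trans hT⟩) (hS.nil ⟨h0.trans hsu, hut, hT⟩)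
    (fun J hJ => hS.chen le_rfl h0 hsu (hut.trans hT) J (by omega))
    (fun J hJ => hS.chen h0 hsu hut hT J (by omega))

theorem exists_isAlmostAdditive_mid (hS : IsPartialExtension T p ω n S) (hω : IsControl T ω)
    (hp : 0 ≤ p) (hI : I.length = n + 1) :
    ∃ C, IsAlmostAdditive T ω (I.length / p) C fun s t => mid (S 0 s) (S s t) I := by
  choose! C hC using hS.bound
  have hshort : ∀ J : List ι, J.length < I.length →
      IsDominated T ω (weight (fun _ => 1) J / p) (C J) fun s t => S s t J := fun J hJ => by
    simpa only [weight_one, Real.norm_eq_abs] using hC J (by omega)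
  refine ⟨mid C C I, mid_nonneg (fun J hJ => (hshort J hJ).const_nonneg)
    (fun J hJ => (hshort J hJ).const_nonneg), fun h0 hsu hut hT => ?_⟩
  rw [hS.mid_sub_sub_mid hI h0 hsu hut hT, norm_neg]
  simpa only [weight_one, Real.norm_eq_abs] using hω.abs_mid_le hp hshort h0 hsu hut hT

/-- The extension of a functional, multiplicative up to level `n`, to the words of length `n + 1`.
Multiplicativity prescribes the defect of additivity of the new level, and any two functions of
intervals with that defect differ by the increments of a path. -/
def extendBy (n : ℕ) (S : ℝ → ℝ → TensorSeries ι) (Z : List ι → ℝ → ℝ) (s t : ℝ) :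
    TensorSeries ι :=
  fun I => if I.length ≤ n then S s t I else incr (Z I) s t - mid (S 0 s) (S s t) I

theorem extendBy_of_le (Z : List ι → ℝ → ℝ) (hI : I.length ≤ n) (s t : ℝ) :
    extendBy n S Z s t I = S s t I := if_pos hI

theorem extendBy_of_lt (Z : List ι → ℝ → ℝ) (hI : n < I.length) (s t : ℝ) :
    extendBy n S Z s t I = incr (Z I) s t - mid (S 0 s) (S s t) I := if_neg hI.not_ge

theorem chen_extendBy (hS : IsPartialExtension T p ω n S) (Z : List ι → ℝ → ℝ)
    (hI : I.length ≤ n + 1) {s u t : ℝ} (h0 : 0 ≤ s) (hsu : s ≤ u) (hut : u ≤ t) (hT : t ≤ T) :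
    extendBy n S Z s t I = tmul (extendBy n S Z s u) (extendBy n S Z u t) I := by
  rcases Nat.lt_or_ge n I.length with hlt | hge
  · rw [tmul_eq_add_mid _ _ (List.length_pos_iff.1 (by omega)),
      mid_congr (fun J hJ => extendBy_of_le Z (by omega) s u)
        (fun J hJ => extendBy_of_le Z (by omega) u t),
      extendBy_of_le (I := []) Z (Nat.zero_le n), extendBy_of_le (I := []) Z (Nat.zero_le n),
      hS.nil ⟨h0, hsu, hut.trans hT⟩, hS.nil ⟨h0.trans hsu, hut, hT⟩,
      extendBy_of_lt Z hlt, extendBy_of_lt Z hlt, extendBy_of_lt Z hlt]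
    simp only [incr]
    linarith [hS.mid_sub_sub_mid (I := I) (by omega) h0 hsu hut hT]
  · rw [extendBy_of_le Z hge, hS.chen h0 hsu hut hT I hge]
    exact (tmul_congr (fun J hJ => extendBy_of_le Z (hJ.trans hge) s u)
      fun J hJ => extendBy_of_le Z (hJ.trans hge) u t).symm

theorem exists_succ (hS : IsPartialExtension T p ω n S) (hω : IsControl T ω) (hp0 : 0 < p)
    (hp : p < n + 1) :
    ∃ S' : ℝ → ℝ → TensorSeries ι, IsPartialExtension T p ω (n + 1) S' ∧
      ∀ (s t : ℝ) (I : List ι), I.length ≤ n → S' s t I = S s t I := by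
  have hsewing : ∀ I : List ι, I.length = n + 1 → ∃ (Z : ℝ → ℝ) (C : ℝ),
      IsDominated T ω (I.length / p) C fun s t => mid (S 0 s) (S s t) I - incr Z s t := by
    intro I hI
    obtain ⟨C, hC⟩ := hS.exists_isAlmostAdditive_mid hω hp0.le hI
    obtain ⟨Z, hZ⟩ := hC.exists_sewing hω (one_lt_natCast_div hp0 hp (by omega))
    exact ⟨Z, _, hZ⟩
  choose! Z hZ using hsewing
  refine ⟨extendBy n S Z, ⟨fun hst => ?_, fun h0 hsu hut hT I hI => ?_, fun I hI => ?_⟩,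
    fun s t I hI => extendBy_of_le Z hI s t⟩
  · rw [extendBy_of_le Z (Nat.zero_le n), hS.nil hst]
  · exact hS.chen_extendBy Z hI h0 hsu hut hT
  · rcases Nat.lt_or_ge n I.length with hlt | hge
    · obtain ⟨C, hC⟩ := hZ I (by omega)
      refine ⟨C, hC.const_nonneg, fun hst => ?_⟩
      rw [extendBy_of_lt Z hlt, norm_sub_rev]
      exact hC.norm_le hst
    · simpa only [extendBy_of_le Z hge] using hS.bound I hge

theorem exists_seq (hS : IsPartialExtension T p ω n S) (hω : IsControl T ω) (hp0 : 0 < p)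
    (hp : p < n + 1) :
    ∃ F : ℕ → ℝ → ℝ → TensorSeries ι, F 0 = S ∧ (∀ k, IsPartialExtension T p ω (n + k) (F k)) ∧
      ∀ k (s t : ℝ) (I : List ι), I.length ≤ n + k → F (k + 1) s t I = F k s t I := by
  have hstep : ∀ k (R : {R : ℝ → ℝ → TensorSeries ι // IsPartialExtension T p ω (n + k) R}),
      ∃ R' : {R : ℝ → ℝ → TensorSeries ι // IsPartialExtension T p ω (n + (k + 1)) R},
        ∀ (s t : ℝ) (I : List ι), I.length ≤ n + k → R'.1 s t I = R.1 s t I := fun k R => by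
    have hpk : p < ((n + k : ℕ) : ℝ) + 1 := by
      push_cast
      linarith [k.cast_nonneg (α := ℝ)]
    obtain ⟨R', hR', hext⟩ := R.2.exists_succ hω hp0 hpk
    exact ⟨⟨R', hR'⟩, hext⟩
  choose next hnext using hstep
  let F : ∀ k, {R : ℝ → ℝ → TensorSeries ι // IsPartialExtension T p ω (n + k) R} :=
    fun k => Nat.rec ⟨S, hS⟩ next k
  exact ⟨fun k => (F k).1, rfl, fun k => (F k).2, fun k => hnext k (F k)⟩

theorem exists_isMultiplicative (hS : IsPartialExtension T p ω n S) (hω : IsControl T ω)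
    (hp0 : 0 < p) (hp : p < n + 1) :
    ∃ S' : ℝ → ℝ → TensorSeries ι, IsMultiplicative T S' ∧
      (∀ I : List ι, ∃ C, IsDominated T ω (I.length / p) C fun s t => S' s t I) ∧
      ∀ (s t : ℝ) (I : List ι), I.length ≤ n → S' s t I = S s t I := by
  obtain ⟨F, hF0, hF, hsucc⟩ := hS.exists_seq hω hp0 hp
  have hstable : ∀ {k l : ℕ}, k ≤ l → ∀ (s t : ℝ) (I : List ι), I.length ≤ n + k →
      F l s t I = F k s t I := by
    intro k l hkl s t I hI
    induction l, hkl using Nat.le_induction with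
    | base => rfl
    | succ l hl ih => rw [hsucc l s t I (by omega), ih]
  have hdiag : ∀ {k : ℕ} (s t : ℝ) (I : List ι), I.length ≤ k → F k s t I = F I.length s t I :=
    fun s t I hI => hstable hI s t I (by omega)
  refine ⟨fun s t I => F I.length s t I, ⟨fun hst => (hF 0).nil hst, fun h0 hsu hut hT => ?_⟩,
    fun I => (hF I.length).bound I (by omega), fun s t I hI => ?_⟩
  · funext I
    rw [(hF I.length).chen h0 hsu hut hT I (by omega)]
    exact tmul_congr (fun J hJ => hdiag _ _ J hJ) fun J hJ => hdiag _ _ J hJ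
  · exact (hstable (Nat.zero_le _) s t I hI).trans (by rw [hF0])

end IsPartialExtension

end Extension

/-! ### The Lyons extension -/

theorem level_get {ι : Type*} (a : TensorSeries ι) (I : List ι) : level I.length a I.get = a I := by
  simp [level]

section Lyons

variable {p T : ℝ} {ι : Type*} [Fintype ι] {X : RoughPath p T ι} {S S' : ℝ → ℝ → TensorSeries ι}

theorem norm_level_le (n : ℕ) (a : TensorSeries ι) :
    ‖level n a‖ ≤ ∑ w : Fin n → ι, |a (List.ofFn w)| := by
  rw [EuclideanSpace.norm_eq]
  refine Real.sqrt_le_iff.2 ⟨Finset.sum_nonneg fun _ _ => abs_nonneg _, ?_⟩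
  exact Finset.sum_sq_le_sq_sum_of_nonneg fun _ _ => abs_nonneg _

namespace IsLyonsExtension

theorem isMultiplicative (hS : IsLyonsExtension X S) : IsMultiplicative T S :=
  ⟨fun hst => hS.level_zero _ _ hst, fun h0 hsu hut hT => hS.chen _ _ _ h0 hsu hut hT⟩

theorem continuousOn_simplex (hS : IsLyonsExtension X S) (I : List ι) :
    ContinuousOn (fun x : ℝ × ℝ => S x.1 x.2 I) (simplex T) := by
  simpa only [Function.comp_def, level_get] using
    (PiLp.continuous_apply 2 (fun _ : Fin I.length → ι => ℝ) I.get).comp_continuousOn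
      (hS.continuousOn I.length)

theorem hasVanishingSums (hS : IsLyonsExtension X S) {I : List ι} (hI : 3 ≤ I.length) :
    HasVanishingSums T fun s t => S s t I := by
  have hlength : (3 : ℝ) ≤ I.length := by exact_mod_cast hI
  have hpos : (0 : ℝ) < I.length := by linarith
  have hr : 0 < p / I.length := div_pos X.pos hpos
  have hr1 : p / I.length < 1 := by
    rw [div_lt_one hpos]
    linarith [X.lt_three]
  have hcoord : ∀ u v, ‖S u v I‖ ≤ ‖level I.length (S u v)‖ := fun u v => by
    rw [← level_get (S u v) I]
    exact PiLp.norm_apply_le _ _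
  exact hasVanishingSums_of_rVar_lt_top hr hr1 (hS.continuousOn_simplex I)
    ((rVar_le_of_norm_le hr hcoord 0 T).trans_lt (hS.rVar_lt I.length (by omega)))
    fun s hs => hS.isMultiplicative.self_eq_zero hs.1 hs.2 (List.length_pos_iff.1 (by omega))

theorem isDominated_of_length_le_two (hS : IsLyonsExtension X S) {I : List ι}
    (hI : I.length ≤ 2) : IsDominated T X.control (I.length / p) 1 fun s t => S s t I := by
  refine ⟨zero_le_one, fun {s t} hst => ?_⟩
  match I, hI with
  | [], _ => simp [hS.level_zero s t hst]
  | [i], _ => simpa [hS.level_one s t hst i] using (X.isDominated_incr i).norm_le hst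
  | [i, j], _ => simpa [hS.level_two s t hst i j] using (X.isDominated_lift i j).norm_le hst

end IsLyonsExtension

theorem exists_isDominated_lyons (p T : ℝ) (I : List ι) :
    ∃ C, ∀ (X : RoughPath p T ι) (S : ℝ → ℝ → TensorSeries ι), IsLyonsExtension X S →
      IsDominated T X.control (I.length / p) C fun s t => S s t I := by
  rcases isEmpty_or_nonempty (RoughPath p T ι) with hempty | ⟨⟨X₀⟩⟩
  · exact ⟨0, fun X => hempty.elim X⟩
  obtain ⟨C, hC⟩ := exists_isDominated_weight (T := T) (fun _ : ι => 1) X₀.pos (n := 2)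
    (C₀ := fun _ => 1) (by norm_num; exact X₀.lt_three) I
  simp only [weight_one] at hC
  exact ⟨C, fun X S hS => hC X.control S X.isControl_control hS.isMultiplicative
    (fun _ => hS.isDominated_of_length_le_two) fun _ => hS.hasVanishingSums⟩

theorem RoughPath.one_lt_length_div (X : RoughPath p T ι) {I : List ι} (hI : 2 < I.length) :
    1 < (I.length : ℝ) / p :=
  one_lt_natCast_div X.pos (by norm_num; exact X.lt_three) hI

theorem IsLyonsExtension.unique (hS : IsLyonsExtension X S) (hS' : IsLyonsExtension X S')
    (I : List ι) {s t : ℝ} (hst : (s, t) ∈ simplex T) : S s t I = S' s t I := by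
  induction hn : I.length using Nat.strong_induction_on generalizing I s t with
  | _ n ih =>
  rcases Nat.lt_or_ge 2 I.length with hlong | hshort
  · have hI : I ≠ [] := List.length_pos_iff.1 (by omega)
    have hadd : IsAdditive T fun s t => S s t I - S' s t I := by
      intro s u t h0 hsu hut hT
      have hmid : mid (S s u) (S u t) I = mid (S' s u) (S' u t) I :=
        mid_congr (fun J hJ => ih _ (hn ▸ hJ) J ⟨h0, hsu, hut.trans hT⟩ rfl)
          fun J hJ => ih _ (hn ▸ hJ) J ⟨h0.trans hsu, hut, hT⟩ rfl
      linarith [hS.isMultiplicative.sub_sub_eq_mid h0 hsu hut hT hI,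
        hS'.isMultiplicative.sub_sub_eq_mid h0 hsu hut hT hI]
    obtain ⟨C, hC⟩ := exists_isDominated_lyons p T I
    have hsum := X.isControl_control.hasVanishingSums (X.one_lt_length_div hlong)
      ((hC X S hS).sub (hC X S' hS'))
    exact sub_eq_zero.1 (hadd.eq_zero hsum hst)
  · match I, hshort with
    | [], _ => rw [hS.level_zero s t hst, hS'.level_zero s t hst]
    | [i], _ => rw [hS.level_one s t hst, hS'.level_one s t hst]
    | [i, j], _ => rw [hS.level_two s t hst, hS'.level_two s t hst]

/-- The tensor series `1 + X_{s,t} + 𝕏_{s,t}`, from which the Lyons extension is built. -/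
def levelTwo (X : RoughPath p T ι) (s t : ℝ) : TensorSeries ι
  | [] => 1
  | [i] => incr X.path s t i
  | [i, j] => X.lift s t (i, j)
  | _ => 0

theorem isPartialExtension_levelTwo (X : RoughPath p T ι) :
    IsPartialExtension T p X.control 2 (levelTwo X) where
  nil _ := rfl
  chen {s u t} h0 hsu hut hT I hI := by
    match I, hI with
    | [], _ => simp [levelTwo, tmul]
    | [i], _ => simp [tmul_cons, tmul_nil, shift, levelTwo, incr]
    | [i, j], _ =>
      simp only [tmul_cons, tmul_nil, shift, levelTwo, X.chen s u t h0 hsu hut hT i j]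
      ring
  bound I hI := by
    refine ⟨1, zero_le_one, fun {s t} hst => ?_⟩
    match I, hI with
    | [], _ => simp [levelTwo]
    | [i], _ => simpa [levelTwo] using (X.isDominated_incr i).norm_le hst
    | [i, j], _ => simpa [levelTwo] using (X.isDominated_lift i j).norm_le hst

theorem isDominated_level {ω : ℝ → ℝ → ℝ} {C : List ι → ℝ} {θ : ℝ} {n : ℕ}
    (hC : ∀ I : List ι, I.length = n → IsDominated T ω θ (C I) fun s t => S s t I) :
    IsDominated T ω θ (∑ w : Fin n → ι, C (List.ofFn w)) fun s t => level n (S s t) where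
  const_nonneg := Finset.sum_nonneg fun w _ => (hC _ (List.length_ofFn ..)).const_nonneg
  norm_le hst := by
    rw [Finset.sum_mul]
    exact (norm_level_le n _).trans
      (Finset.sum_le_sum fun w _ => (hC _ (List.length_ofFn ..)).norm_le hst)

theorem exists_isLyonsExtension (X : RoughPath p T ι) : ∃ S, IsLyonsExtension X S := by
  have hω := X.isControl_control
  obtain ⟨S, hS, hbound, heq⟩ := (isPartialExtension_levelTwo X).exists_isMultiplicative hω X.pos
    (by norm_num; exact X.lt_three)
  choose C hC using hbound
  have hcont : ∀ I, ContinuousOn (fun x : ℝ × ℝ => S x.1 x.2 I) (simplex T) :=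
    hS.continuousOn_simplex (hS.continuousOn_zero hω (w := fun _ => 1) X.pos
      (by simpa only [weight_one] using hC) fun _ => one_pos)
  exact ⟨S, {
    level_zero := fun _ _ hst => hS.nil hst
    level_one := fun s t _ i => heq s t [i] (by simp)
    level_two := fun s t _ i j => heq s t [i, j] (by simp)
    chen := fun _ _ _ h0 hsu hut hT => hS.chen h0 hsu hut hT
    continuousOn := fun n => (PiLp.continuous_toLp 2 _).comp_continuousOn
      (continuousOn_pi.2 fun w => hcont _)
    rVar_lt := fun n hn => by
      have hn' : (0 : ℝ) < n := by exact_mod_cast hn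
      have hlevel : IsDominated T X.control (1 / (p / n)) (∑ w : Fin n → ι, C (List.ofFn w))
          fun s t => level n (S s t) := by
        rw [one_div_div]
        exact isDominated_level fun I hI => hI ▸ hC I
      exact hlevel.rVar_lt_top (div_pos X.pos hn') hω }⟩

theorem isLyonsExtension_signature (X : RoughPath p T ι) :
    IsLyonsExtension X (signature X) := by
  have hexists := exists_isLyonsExtension X
  rw [signature, dif_pos hexists]
  exact hexists.choose_spec

theorem abs_signature_sub_sum_mid_le (X : RoughPath p T ι) {I : List ι} (hI : I ≠ []) {C θ : ℝ}
    (hC : IsDominated T X.control θ C fun s t => signature X s t I) {s t : ℝ}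
    (hst : (s, t) ∈ simplex T) {N : ℕ} {u : ℕ → ℝ} (hu : IsPartition s t N u) :
    |signature X s t I
        - ∑ i ∈ Finset.range N, mid (signature X s (u i)) (signature X (u i) (u (i + 1))) I|
      ≤ C * ∑ i ∈ Finset.range N, X.control (u i) (u (i + 1)) ^ θ := by
  have hS := (isLyonsExtension_signature X).isMultiplicative
  rw [hS.eq_sum_add_sum_mid hst hu hI, add_sub_cancel_right]
  exact hC.norm_sum_le hst hu

/-- Along a fixed partition, the sums of the `mid` terms only involve shorter words, and by
`abs_signature_sub_sum_mid_le` they approximate the coordinate locally uniformly in `X`. -/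
theorem continuous_signature_of_shorter {I : List ι} (hlong : 2 < I.length)
    (hshort : ∀ J : List ι, J.length < I.length → ∀ {s t : ℝ}, (s, t) ∈ simplex T →
      Continuous fun X : RoughPath p T ι => signature X s t J)
    {s t : ℝ} (hst : (s, t) ∈ simplex T) :
    Continuous fun X : RoughPath p T ι => signature X s t I := by
  have hI : I ≠ [] := List.length_pos_iff.1 (by omega)
  obtain ⟨C, hC⟩ := exists_isDominated_lyons p T I
  refine continuous_iff_continuousAt.2 fun X =>
    continuousAt_of_locally_uniform_approx_of_continuousAt fun V hV => ?_
  obtain ⟨ε, hε, hεV⟩ := Metric.mem_uniformity_dist.1 hV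
  have hθ := X.one_lt_length_div hlong
  have hC0 : 0 ≤ C := (hC X _ (isLyonsExtension_signature X)).const_nonneg
  obtain ⟨N, u, hu, hlt⟩ := X.isControl_control.exists_partition_sum_rpow_lt hst hθ
    (show 0 < ε / (C + 1) by positivity)
  have hmem : ∀ i ∈ Finset.range N, (u i, u (i + 1)) ∈ simplex T := fun i hi =>
    hu.mem_simplex hst (Finset.mem_range.1 hi)
  have hstart : ∀ i ∈ Finset.range N, (s, u i) ∈ simplex T := fun i hi =>
    ⟨hst.1, hu.left_le (Finset.mem_range.1 hi).le, (hmem i hi).2.1.trans (hmem i hi).2.2⟩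
  have hcontrol : Continuous fun Y : RoughPath p T ι =>
      ∑ i ∈ Finset.range N, Y.control (u i) (u (i + 1)) ^ ((I.length : ℝ) / p) :=
    continuous_finsetSum _ fun i hi => (RoughPath.continuous_control (hmem i hi)).rpow_const
      fun _ => Or.inr (zero_le_one.trans hθ.le)
  have hsum : Continuous fun Y : RoughPath p T ι =>
      ∑ i ∈ Finset.range N, mid (signature Y s (u i)) (signature Y (u i) (u (i + 1))) I :=
    continuous_finsetSum _ fun i hi => continuous_finsetSum _ fun k hk =>
      (hshort _ (length_take_lt hk) (hstart i hi)).mul (hshort _ (length_drop_lt hk) (hmem i hi))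
  refine ⟨_, hcontrol.continuousAt.eventually_lt_const hlt, _, hsum.continuousAt,
    fun Y hY => hεV ?_⟩
  calc dist _ _ ≤ C * ∑ i ∈ Finset.range N, Y.control (u i) (u (i + 1)) ^ (I.length / p) :=
        abs_signature_sub_sum_mid_le Y hI (hC Y _ (isLyonsExtension_signature Y)) hst hu
    _ ≤ C * (ε / (C + 1)) := mul_le_mul_of_nonneg_left hY.le hC0
    _ < ε := by
        rw [← mul_div_assoc, div_lt_iff₀ (by linarith)]
        nlinarith

theorem continuous_signature (I : List ι) {s t : ℝ} (hst : (s, t) ∈ simplex T) :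
    Continuous fun X : RoughPath p T ι => signature X s t I := by
  induction hn : I.length using Nat.strong_induction_on generalizing I s t with
  | _ n ih =>
  rcases Nat.lt_or_ge 2 I.length with hlong | hshort
  · exact continuous_signature_of_shorter hlong (fun J hJ _ _ h => ih _ (hn ▸ hJ) J h rfl) hst
  · have hL := isLyonsExtension_signature (p := p) (T := T) (ι := ι)
    match I, hshort with
    | [], _ => simpa only [(hL _).level_zero s t hst] using continuous_const
    | [i], _ => simpa only [(hL _).level_one s t hst] using RoughPath.continuous_incr hst i
    | [i, j], _ => simpa only [(hL _).level_two s t hst] using RoughPath.continuous_lift hst i j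

end Lyons

/-! ### Extended rough paths -/

section Extended

theorem IsDominated.mono_control {E : Type*} [NormedAddCommGroup E] {T θ C : ℝ}
    {ω ω' : ℝ → ℝ → ℝ} {A : ℝ → ℝ → E} (hω : IsControl T ω)
    (hle : ∀ {s t : ℝ}, (s, t) ∈ simplex T → ω s t ≤ ω' s t) (hθ : 0 ≤ θ)
    (hA : IsDominated T ω θ C A) : IsDominated T ω' θ C A :=
  ⟨hA.const_nonneg, fun hst => (hA.norm_le hst).trans (mul_le_mul_of_nonneg_left
    (Real.rpow_le_rpow (hω.nonneg hst) (hle hst) hθ) hA.const_nonneg)⟩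

theorem mid_pair {ι : Type*} (a b : TensorSeries ι) (x y : ι) :
    mid a b [x, y] = a [x] * b [y] := by simp [mid]

theorem IsLyonsExtension.hasVanishingSums_of_isYoungIntegral {p T : ℝ} {ι : Type*} [Fintype ι]
    {X : RoughPath p T ι} {S : ℝ → ℝ → TensorSeries ι} (hS : IsLyonsExtension X S) {a b : ι}
    (hYoung : ∀ s t : ℝ, (s, t) ∈ simplex T →
      IsYoungIntegral (fun r => incr X.path s r a) (fun r => X.path r b) s t (X.lift s t (a, b))) :
    HasVanishingSums T fun s t => S s t [a, b] := by
  intro s t hst ε hε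
  obtain ⟨δ, hδ, hRiemann⟩ := hYoung s t hst ε hε
  obtain ⟨N, u, hu, hmesh⟩ := (IsControl.length T).exists_fine_partition hst hδ
  refine ⟨N, u, hu, ?_⟩
  have hsum : ∑ i ∈ Finset.range N, mid (S s (u i)) (S (u i) (u (i + 1))) [a, b]
      = ∑ i ∈ Finset.range N, incr X.path s (u i) a * (X.path (u (i + 1)) b - X.path (u i) b) := by
    refine Finset.sum_congr rfl fun i hi => ?_
    have hi := Finset.mem_range.1 hi
    have hstep := hu.mem_simplex hst hi
    have hstart : (s, u i) ∈ simplex T := ⟨hst.1, hu.left_le hi.le, hstep.2.1.trans hstep.2.2⟩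
    rw [mid_pair, hS.level_one _ _ hstart, hS.level_one _ _ hstep]
    simp only [incr, PiLp.sub_apply]
  have hsplit := hS.isMultiplicative.eq_sum_add_sum_mid hst hu (I := [a, b]) (by simp)
  rw [hsum, hS.level_two s t hst] at hsplit
  have hclose := hRiemann N u hu hmesh
  rwa [hsplit, abs_sub_comm, add_sub_cancel_right] at hclose

variable {p T : ℝ} {d : ℕ} {s t : ℝ}

/-- The index of the time component of the extended path. -/
abbrev ExtIndex.time : ExtIndex d := Sum.inl ()

/-- The index of a bracket component of the extended path. -/
abbrev ExtIndex.ofBracket (ij : {ij : Fin d × Fin d // ij.1 ≤ ij.2}) : ExtIndex d :=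
  Sum.inr (Sum.inr ij)

/-- The weights of the letters: `X` has finite `p`-variation, its bracket has finite
`p/2`-variation, and so does time. -/
def extWeight : ExtIndex d → ℕ := Sum.elim (fun _ => 2) (Sum.elim (fun _ => 1) (fun _ => 2))

/-- The product of letters: the bracket of two components of `X`, and zero otherwise. -/
def extBracket : ExtIndex d → ExtIndex d → Option (ExtIndex d)
  | Sum.inr (Sum.inl i), Sum.inr (Sum.inl j) =>
    some (ExtIndex.ofBracket ⟨(min i j, max i j), min_le_max⟩)
  | _, _ => none

theorem extWeight_pos (a : ExtIndex d) : 0 < extWeight a := by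
  rcases a with _ | _ | _ <;> simp [extWeight]

theorem extWeight_extBracket (a b c : ExtIndex d) (h : extBracket a b = some c) :
    extWeight c = extWeight a + extWeight b := by
  rcases a with _ | _ | _ <;> rcases b with _ | _ | _ <;>
    simp only [extBracket, Option.some.injEq, reduceCtorEq] at h
  rw [← h]
  rfl

theorem eq_ofPath_of_weight_le_one {I : List (ExtIndex d)} (hI : I ≠ [])
    (hweight : weight extWeight I ≤ 1) : ∃ i, I = [ExtIndex.ofPath i] := by
  obtain ⟨a, I, rfl⟩ := List.exists_cons_of_ne_nil hI
  rw [weight_cons] at hweight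
  obtain rfl : I = [] := by
    by_contra hne
    have ha := extWeight_pos a
    have hpos := weight_pos extWeight_pos hne
    omega
  rcases a with _ | i | _
  · simp [extWeight] at hweight
  · exact ⟨i, rfl⟩
  · simp [extWeight] at hweight

variable {Y Y' : RoughPath p T (ExtIndex d)}

theorem incr_time (hY : Y ∈ extendedRoughPaths p T d) (hst : (s, t) ∈ simplex T) :
    incr Y.path s t ExtIndex.time = t - s := by
  obtain ⟨X, hpath, -, -⟩ := hY
  simp [incr, hpath t ⟨hst.1.trans hst.2.1, hst.2.2⟩, hpath s ⟨hst.1, hst.2.1.trans hst.2.2⟩,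
    extPath]

theorem incr_ofBracket (hY : Y ∈ extendedRoughPaths p T d) (hst : (s, t) ∈ simplex T)
    (ij : {ij : Fin d × Fin d // ij.1 ≤ ij.2}) :
    incr Y.path s t (ExtIndex.ofBracket ij)
      = incr Y.path s t (ExtIndex.ofPath ij.1.1) * incr Y.path s t (ExtIndex.ofPath ij.1.2)
        - (Y.lift s t (ExtIndex.ofPath ij.1.1, ExtIndex.ofPath ij.1.2)
          + Y.lift s t (ExtIndex.ofPath ij.1.2, ExtIndex.ofPath ij.1.1)) := by
  obtain ⟨X, hpath, hlift, -⟩ := hY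
  have hchen := X.chen 0 s t le_rfl hst.1 hst.2.1 hst.2.2
  simp only [incr, PiLp.sub_apply] at hchen
  simp only [incr, PiLp.sub_apply, hlift s t hst, hpath t ⟨hst.1.trans hst.2.1, hst.2.2⟩,
    hpath s ⟨hst.1, hst.2.1.trans hst.2.2⟩, extPath, RoughPath.bracket, Prod.swap, Sum.elim_inl,
    Sum.elim_inr, hchen]
  ring

/-- A control for extended rough paths, which also controls time. -/
def extControl (Y : RoughPath p T (ExtIndex d)) (s t : ℝ) : ℝ := Y.control s t + (t - s)

theorem isControl_extControl (Y : RoughPath p T (ExtIndex d)) : IsControl T (extControl Y) :=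
  Y.isControl_control.add (IsControl.length T)

theorem IsDominated.extControl {E : Type*} [NormedAddCommGroup E] {A : ℝ → ℝ → E} {θ C : ℝ}
    (hθ : 0 ≤ θ) (hA : IsDominated T Y.control θ C A) : IsDominated T (extControl Y) θ C A :=
  hA.mono_control Y.isControl_control (fun hst => le_add_of_nonneg_right (sub_nonneg.2 hst.2.1)) hθ

theorem exists_isDominated_time (Y : RoughPath p T (ExtIndex d)) (hT : 0 ≤ T) :
    ∃ C, IsDominated T (extControl Y) (2 / p) C fun s t => t - s := by
  have hp := Y.pos
  have hlength : IsDominated T (fun s t => t - s) 1 1 fun s t => t - s :=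
    ⟨zero_le_one, fun hst => by
      rw [Real.rpow_one, one_mul, Real.norm_of_nonneg (sub_nonneg.2 hst.2.1)]⟩
  have hp2 : 2 / p ≤ 1 := (div_le_one hp).2 Y.two_le
  exact ⟨_, (hlength.mono_exponent (IsControl.length T) hT (by positivity) hp2).mono_control
    (IsControl.length T)
    (fun hst => le_add_of_nonneg_left (Y.isControl_control.nonneg hst)) (by positivity)⟩

theorem exists_isDominated_incr_ofBracket (hY : Y ∈ extendedRoughPaths p T d)
    (ij : {ij : Fin d × Fin d // ij.1 ≤ ij.2}) :
    ∃ C, IsDominated T (extControl Y) (2 / p) C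
      fun s t => incr Y.path s t (ExtIndex.ofBracket ij) := by
  have hp := Y.pos
  have hprod := (Y.isDominated_incr (ExtIndex.ofPath ij.1.1)).mul Y.isControl_control
    (by positivity) (by positivity) (Y.isDominated_incr (ExtIndex.ofPath ij.1.2))
  rw [← add_div, one_add_one_eq_two] at hprod
  have hsub := hprod.sub
    ((Y.isDominated_lift (ExtIndex.ofPath ij.1.1) (ExtIndex.ofPath ij.1.2)).add
      (Y.isDominated_lift (ExtIndex.ofPath ij.1.2) (ExtIndex.ofPath ij.1.1)))
  refine ⟨_, hsub.const_nonneg, fun hst => ?_⟩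
  rw [incr_ofBracket hY hst]
  exact (hsub.extControl (by positivity)).norm_le hst

theorem exists_isDominated_of_weight_le_two (hY : Y ∈ extendedRoughPaths p T d) (hT : 0 ≤ T)
    {S : ℝ → ℝ → TensorSeries (ExtIndex d)} (hS : IsLyonsExtension Y S) {I : List (ExtIndex d)}
    (hI : weight extWeight I ≤ 2) :
    ∃ C, IsDominated T (extControl Y) (weight extWeight I / p) C fun s t => S s t I := by
  have hp := Y.pos
  have hshort : I.length ≤ 2 → weight extWeight I = I.length →
      ∃ C, IsDominated T (extControl Y) (weight extWeight I / p) C fun s t => S s t I :=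
    fun hlength heq => ⟨1, heq ▸
      (hS.isDominated_of_length_le_two hlength).extControl (by positivity)⟩
  match I with
  | [] => exact hshort (by simp) (by simp)
  | [Sum.inl ()] =>
    obtain ⟨C, hC⟩ := exists_isDominated_time Y hT
    refine ⟨C, hC.const_nonneg, fun hst => ?_⟩
    rw [hS.level_one _ _ hst, incr_time hY hst]
    exact hC.norm_le hst
  | [Sum.inr (Sum.inl i)] => exact hshort (by simp) (by simp [extWeight])
  | [Sum.inr (Sum.inr ij)] =>
    obtain ⟨C, hC⟩ := exists_isDominated_incr_ofBracket hY ij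
    refine ⟨C, hC.const_nonneg, fun hst => ?_⟩
    rw [hS.level_one _ _ hst]
    exact hC.norm_le hst
  | [a, b] =>
    have ha := extWeight_pos a
    have hb := extWeight_pos b
    simp only [weight_cons, weight_nil] at hI
    exact hshort le_rfl
      (by simp only [weight_cons, weight_nil, List.length_cons, List.length_nil]; omega)
  | a :: b :: c :: I =>
    have ha := extWeight_pos a
    have hb := extWeight_pos b
    have hc := extWeight_pos c
    simp only [weight_cons] at hI
    omega

theorem hasVanishingSums_of_two_lt_weight (hY : Y ∈ extendedRoughPaths p T d)
    {S : ℝ → ℝ → TensorSeries (ExtIndex d)} (hS : IsLyonsExtension Y S) {I : List (ExtIndex d)}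
    (hI : 2 < weight extWeight I) : HasVanishingSums T fun s t => S s t I := by
  match I with
  | [] => simp at hI
  | [a] => rcases a with _ | _ | _ <;> simp [extWeight] at hI
  | [a, b] =>
    obtain ⟨X, -, -, hYoung⟩ := hY
    refine hS.hasVanishingSums_of_isYoungIntegral fun s t hst => hYoung s t hst a b ?_
    rintro ⟨⟨i, rfl⟩, ⟨j, rfl⟩⟩
    simp [extWeight] at hI
  | a :: b :: c :: I => exact hS.hasVanishingSums (by simp)

theorem exists_isDominated_extWeight (hY : Y ∈ extendedRoughPaths p T d)
    {S : ℝ → ℝ → TensorSeries (ExtIndex d)} (hS : IsLyonsExtension Y S) (hT : 0 ≤ T)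
    (I : List (ExtIndex d)) :
    ∃ C, IsDominated T (extControl Y) (weight extWeight I / p) C fun s t => S s t I := by
  choose! C₀ hC₀ using fun I (hI : weight extWeight I ≤ 2) =>
    exists_isDominated_of_weight_le_two hY hT hS hI
  obtain ⟨C, hC⟩ := exists_isDominated_weight (T := T) extWeight Y.pos (n := 2) (C₀ := C₀)
    (by norm_num; exact Y.lt_three) I
  exact ⟨C, hC _ S (isControl_extControl Y) hS.isMultiplicative hC₀
    fun _ => hasVanishingSums_of_two_lt_weight hY hS⟩

theorem IsLyonsExtension.mul_eq_qeval (hY : Y ∈ extendedRoughPaths p T d)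
    {S : ℝ → ℝ → TensorSeries (ExtIndex d)} (hS : IsLyonsExtension Y S)
    (I J : List (ExtIndex d)) (hst : (s, t) ∈ simplex T) :
    S s t I * S s t J = qeval extBracket (S s t) I J := by
  have hT : 0 ≤ T := hst.1.trans (hst.2.1.trans hst.2.2)
  choose C hC using exists_isDominated_extWeight hY hS hT
  refine hS.isMultiplicative.mul_eq_qeval (isControl_extControl Y) Y.pos (n := 2)
    (by norm_num; exact Y.lt_three) hC extWeight_extBracket
    (fun I J hI hJ hIJ s t hst => ?_) I J hst
  have hIpos := weight_pos extWeight_pos hI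
  have hJpos := weight_pos extWeight_pos hJ
  obtain ⟨i, rfl⟩ := eq_ofPath_of_weight_le_one hI (by omega)
  obtain ⟨j, rfl⟩ := eq_ofPath_of_weight_le_one hJ (by omega)
  simp only [qeval_cons_cons, qeval_nil_left, qeval_nil_right, shift, extBracket, Option.elim_some,
    hS.level_one s t hst, hS.level_two s t hst, incr_ofBracket hY hst]
  rcases le_total i j with hij | hij
  · simp only [min_eq_left hij, max_eq_right hij]
    ring
  · simp only [min_eq_right hij, max_eq_left hij]
    ring

theorem IsLyonsExtension.append_time (hY : Y ∈ extendedRoughPaths p T d)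
    {S : ℝ → ℝ → TensorSeries (ExtIndex d)} (hS : IsLyonsExtension Y S)
    (I : List (ExtIndex d)) (ht : t ∈ Set.Icc 0 T) :
    S 0 t (I ++ [ExtIndex.time]) = ∫ r in (0 : ℝ)..t, S 0 r I := by
  choose C hC using exists_isDominated_extWeight hY hS (ht.1.trans ht.2)
  refine hS.isMultiplicative.eq_integral (isControl_extControl Y) Y.pos hC extWeight_pos
    (by norm_num [extWeight]; exact Y.lt_three) (fun hst => ?_) I ht
  rw [hS.level_one _ _ hst, incr_time hY hst]

theorem IsLyonsExtension.continuousOn_zero {ι : Type*} [Fintype ι] {X : RoughPath p T ι}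
    {S : ℝ → ℝ → TensorSeries ι} (hS : IsLyonsExtension X S) (I : List ι) :
    ContinuousOn (fun t => S 0 t I) (Set.Icc 0 T) :=
  (hS.continuousOn_simplex I).comp (f := fun t : ℝ => ((0 : ℝ), t)) (by fun_prop)
    fun _ ht => ⟨le_rfl, ht.1, ht.2⟩

theorem IsLyonsExtension.eq_of_terminal_eq (hY : Y ∈ extendedRoughPaths p T d)
    (hY' : Y' ∈ extendedRoughPaths p T d) {S S' : ℝ → ℝ → TensorSeries (ExtIndex d)}
    (hS : IsLyonsExtension Y S) (hS' : IsLyonsExtension Y' S') (hT : 0 < T)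
    (h : S 0 T = S' 0 T) (I : List (ExtIndex d)) (ht : t ∈ Set.Icc 0 T) :
    S 0 t I = S' 0 t I := by
  have hint : ∀ {J : List (ExtIndex d)} {r : ℝ}, r ∈ Set.Icc 0 T →
      IntervalIntegrable (fun r => S 0 r J) MeasureTheory.volume 0 r ∧
        IntervalIntegrable (fun r => S' 0 r J) MeasureTheory.volume 0 r := fun {J r} hr =>
    ⟨((hS.continuousOn_zero J).mono
        (Set.Icc_subset_Icc le_rfl hr.2)).intervalIntegrable_of_Icc hr.1,
      ((hS'.continuousOn_zero J).mono
        (Set.Icc_subset_Icc le_rfl hr.2)).intervalIntegrable_of_Icc hr.1⟩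
  have hzero := eq_zero_of_iterated_integrals_eq_zero hT
    (G := fun k t => S 0 t (I ++ List.replicate k ExtIndex.time)
      - S' 0 t (I ++ List.replicate k ExtIndex.time))
    (fun k => (hS.continuousOn_zero _).sub (hS'.continuousOn_zero _))
    (fun k r hr => by
      rw [intervalIntegral.integral_sub (hint hr).1 (hint hr).2, ← hS.append_time hY _ hr,
        ← hS'.append_time hY' _ hr, List.replicate_succ', List.append_assoc])
    (fun k => by rw [h, sub_self]) ht
  simpa only [List.replicate_zero, List.append_nil, sub_eq_zero] using hzero

end Extended

/-! ### Separation of extended rough paths -/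

section Separation

variable {p T : ℝ} {ι : Type*} [Fintype ι] {d : ℕ}

theorem rVar_eq_zero {E : Type*} [NormedAddCommGroup E] {r : ℝ} (hr : 0 < r) {A : ℝ → ℝ → E}
    {s t : ℝ} (h : ∀ u v : ℝ, s ≤ u → u ≤ v → v ≤ t → A u v = 0) : rVar r A s t = 0 := by
  rw [rVar, one_div, ENNReal.rpow_eq_zero_iff_of_pos (inv_pos.2 hr)]
  simp only [ENNReal.iSup_eq_zero]
  refine fun N u hu => Finset.sum_eq_zero fun i hi => ?_
  have hi := Finset.mem_range.1 hi
  rw [h _ _ (hu.left_le hi.le) (hu.2.2 i hi).le (hu.le_right hi), enorm_zero,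
    ENNReal.zero_rpow_of_pos hr]

theorem incr_eq_sub_incr {E : Type*} [NormedAddCommGroup E] (X : ℝ → E) (r s t : ℝ) :
    incr X s t = incr X r t - incr X r s := (sub_sub_sub_cancel_right _ _ _).symm

theorem RoughPath.inseparable_of_eq_from_zero {X Y : RoughPath p T ι}
    (hpath : ∀ t ∈ Set.Icc 0 T, incr X.path 0 t = incr Y.path 0 t)
    (hlift : ∀ t ∈ Set.Icc 0 T, X.lift 0 t = Y.lift 0 t) : Inseparable X Y := by
  have hpath' : ∀ s t : ℝ, 0 ≤ s → s ≤ t → t ≤ T → incr X.path s t = incr Y.path s t :=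
    fun s t h0 hst ht => by
      rw [incr_eq_sub_incr _ 0, hpath t ⟨h0.trans hst, ht⟩, hpath s ⟨h0, hst.trans ht⟩,
        ← incr_eq_sub_incr]
  have hlift' : ∀ s t : ℝ, 0 ≤ s → s ≤ t → t ≤ T → X.lift s t = Y.lift s t := by
    intro s t h0 hst ht
    ext ⟨a, b⟩
    have hX := X.chen 0 s t le_rfl h0 hst ht a b
    rw [hlift t ⟨h0.trans hst, ht⟩, hlift s ⟨h0, hst.trans ht⟩, hpath s ⟨h0, hst.trans ht⟩,
      hpath' s t h0 hst ht, Y.chen 0 s t le_rfl h0 hst ht a b] at hX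
    linarith
  have hdist : rVar p (fun s t => incr X.path s t - incr Y.path s t) 0 T
      + rVar (p / 2) (fun s t => X.lift s t - Y.lift s t) 0 T = 0 := by
    rw [rVar_eq_zero X.pos fun u v h0 huv hv => sub_eq_zero.2 (hpath' u v h0 huv hv),
      rVar_eq_zero (half_pos X.pos) fun u v h0 huv hv => sub_eq_zero.2 (hlift' u v h0 huv hv),
      add_zero]
  exact EMetric.inseparable_iff.2 hdist

theorem inseparable_of_signature_eq (hT : 0 < T) {Y Y' : RoughPath p T (ExtIndex d)}
    (hY : Y ∈ extendedRoughPaths p T d) (hY' : Y' ∈ extendedRoughPaths p T d)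
    (h : signature Y 0 T = signature Y' 0 T) : Inseparable Y Y' := by
  have hS := isLyonsExtension_signature Y
  have hS' := isLyonsExtension_signature Y'
  have heq : ∀ I, ∀ t ∈ Set.Icc 0 T, signature Y 0 t I = signature Y' 0 t I :=
    fun I t ht => hS.eq_of_terminal_eq hY hY' hS' hT h I ht
  refine RoughPath.inseparable_of_eq_from_zero (fun t ht => ?_) fun t ht => ?_
  · ext a
    rw [← hS.level_one 0 t ⟨le_rfl, ht⟩, ← hS'.level_one 0 t ⟨le_rfl, ht⟩, heq _ t ht]
  · ext ⟨a, b⟩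
    rw [← hS.level_two 0 t ⟨le_rfl, ht⟩, ← hS'.level_two 0 t ⟨le_rfl, ht⟩, heq _ t ht]

end Separation

/-! ### Density of the linear functionals of the signature -/

section StoneWeierstrass

variable {X κ : Type*} [TopologicalSpace X] [CompactSpace X]

theorem exists_mem_subalgebra_near_of_inseparable (A : Subalgebra ℝ C(X, ℝ))
    (hA : ∀ x y, (∀ g ∈ A, g x = g y) → Inseparable x y) (f : C(X, ℝ)) {ε : ℝ} (hε : 0 < ε) :
    ∃ g ∈ A, ∀ x, |f x - g x| < ε := by
  have : CompactSpace (SeparationQuotient X) :=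
    SeparationQuotient.surjective_mk.compactSpace SeparationQuotient.continuous_mk
  let mk : C(X, SeparationQuotient X) := ⟨SeparationQuotient.mk, SeparationQuotient.continuous_mk⟩
  let descend (g : C(X, ℝ)) : C(SeparationQuotient X, ℝ) :=
    ⟨SeparationQuotient.lift g fun _ _ h => (h.map g.continuous).eq,
      SeparationQuotient.continuous_lift g.continuous⟩
  have hdescend : ∀ g : C(X, ℝ), (descend g).comp mk = g := fun g => rfl
  let B := A.comap (ContinuousMap.compRightAlgHom ℝ ℝ mk)
  have hsep : B.SeparatesPoints := by
    intro x y hxy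
    obtain ⟨x, rfl⟩ := SeparationQuotient.surjective_mk x
    obtain ⟨y, rfl⟩ := SeparationQuotient.surjective_mk y
    by_contra! hcon
    refine hxy (SeparationQuotient.mk_eq_mk.2 (hA x y fun g hg => ?_))
    exact hcon (descend g) ⟨descend g, show (descend g).comp mk ∈ A from hdescend g ▸ hg, rfl⟩
  obtain ⟨⟨g, hg⟩, hgf⟩ :=
    ContinuousMap.exists_mem_subalgebra_near_continuousMap_of_separatesPoints B hsep (descend f)
      ε hε
  refine ⟨g.comp mk, hg, fun x => ?_⟩
  rw [abs_sub_comm]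
  exact (ContinuousMap.norm_lt_iff _ hε).1 hgf (mk x)

theorem exists_linearCombination_near (φ : κ → C(X, ℝ)) (hone : 1 ∈ Set.range φ)
    (hmul : ∀ i j, φ i * φ j ∈ Submodule.span ℝ (Set.range φ))
    (hsep : ∀ x y, (∀ i, φ i x = φ i y) → Inseparable x y) (f : C(X, ℝ)) {ε : ℝ} (hε : 0 < ε) :
    ∃ ℓ : κ →₀ ℝ, ∀ x, |f x - ℓ.sum fun i c => c * φ i x| < ε := by
  let A := (Submodule.span ℝ (Set.range φ)).toSubalgebra (Submodule.subset_span hone)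
    fun g g' hg hg' => by
      have hgg' := Submodule.mul_mem_mul hg hg'
      rw [Submodule.span_mul_span] at hgg'
      refine Submodule.span_le.2 ?_ hgg'
      rintro _ ⟨_, ⟨i, rfl⟩, _, ⟨j, rfl⟩, rfl⟩
      exact hmul i j
  obtain ⟨g, hg, hgf⟩ := exists_mem_subalgebra_near_of_inseparable A
    (fun x y h => hsep x y fun i => h (φ i) (Submodule.subset_span ⟨i, rfl⟩)) f hε
  obtain ⟨ℓ, rfl⟩ := Finsupp.mem_span_range_iff_exists_finsupp.1 hg
  refine ⟨ℓ, fun x => ?_⟩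
  simpa only [Finsupp.sum, ContinuousMap.sum_apply, ContinuousMap.smul_apply, smul_eq_mul]
    using hgf x

end StoneWeierstrass

section Density

variable {p T : ℝ} {d : ℕ} {K : Set (RoughPath p T (ExtIndex d))}

/-- The coordinate of the terminal signature `𝕏_{0,T}` on the word `I`, as a continuous function on
a set of rough paths. -/
def signatureCoord (hT : 0 ≤ T) (K : Set (RoughPath p T (ExtIndex d))) (I : List (ExtIndex d)) :
    C(K, ℝ) where
  toFun X := signature X.1 0 T I
  continuous_toFun := (continuous_signature I ⟨le_rfl, hT, le_rfl⟩).comp continuous_subtype_val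

theorem signatureCoord_mul (hT : 0 ≤ T) (hK : K ⊆ extendedRoughPaths p T d)
    (I J : List (ExtIndex d)) :
    signatureCoord hT K I * signatureCoord hT K J
      = ((quasiShuffle extBracket I J).map (signatureCoord hT K)).sum := by
  ext X
  refine ((isLyonsExtension_signature X.1).mul_eq_qeval (hK X.2) I J ⟨le_rfl, hT, le_rfl⟩).trans ?_
  have heval := map_list_sum (ContinuousMap.evalAlgHom ℝ ℝ X)
    ((quasiShuffle extBracket I J).map (signatureCoord hT K))
  rw [List.map_map] at heval
  exact heval.symm

theorem exists_pairing_near (hT : 0 < T) (hK : K ⊆ extendedRoughPaths p T d) (hKc : IsCompact K)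
    {f : RoughPath p T (ExtIndex d) → ℝ} (hf : ContinuousOn f K) {ε : ℝ} (hε : 0 < ε) :
    ∃ ℓ : List (ExtIndex d) →₀ ℝ, ∀ X ∈ K, |f X - pairing ℓ (signature X 0 T)| < ε := by
  have : CompactSpace K := isCompact_iff_compactSpace.1 hKc
  have hone : signatureCoord hT.le K [] = 1 := by
    ext X
    exact (isLyonsExtension_signature X.1).level_zero 0 T ⟨le_rfl, hT.le, le_rfl⟩
  have hmul : ∀ I J, signatureCoord hT.le K I * signatureCoord hT.le K J
      ∈ Submodule.span ℝ (Set.range (signatureCoord hT.le K)) := by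
    intro I J
    rw [signatureCoord_mul hT.le hK]
    refine list_sum_mem fun g hg => ?_
    obtain ⟨L, -, rfl⟩ := List.mem_map.1 hg
    exact Submodule.subset_span ⟨L, rfl⟩
  have hsep : ∀ X Y : K, (∀ I, signatureCoord hT.le K I X = signatureCoord hT.le K I Y) →
      Inseparable X Y := fun X Y h => Topology.IsInducing.subtypeVal.inseparable_iff.1
    (inseparable_of_signature_eq hT (hK X.2) (hK Y.2) (funext h))
  obtain ⟨ℓ, hℓ⟩ := exists_linearCombination_near (signatureCoord hT.le K) ⟨[], hone⟩ hmul hsep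
    ⟨fun X : K => f X, continuousOn_iff_continuous_domRestrict.1 hf⟩ hε
  exact ⟨ℓ, fun X hX => hℓ ⟨X, hX⟩⟩

end Density

end RoughUAT

end

open RoughUAT in
theorem mainTheorem1_general (p T : ℝ) (hT : 0 < T) (d : ℕ)
    (K : Set (RoughPath p T (ExtIndex d))) (hK : K ⊆ extendedRoughPaths p T d)
    (hKc : IsCompact K) (f : RoughPath p T (ExtIndex d) → ℝ) (hf : ContinuousOn f K) :
    (∀ X : RoughPath p T (ExtIndex d), IsLyonsExtension X (signature X) ∧
      ∀ S, IsLyonsExtension X S → ∀ s t : ℝ, (s, t) ∈ simplex T → S s t = signature X s t) ∧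
    ∀ ε : ℝ, 0 < ε → ∃ ℓ : List (ExtIndex d) →₀ ℝ,
      (⨆ X ∈ K, ENNReal.ofReal |f X - pairing ℓ (signature X 0 T)|) < ENNReal.ofReal ε := by
  refine ⟨fun X => ⟨isLyonsExtension_signature X, fun S hS s t hst => ?_⟩, fun ε hε => ?_⟩
  · funext I
    exact hS.unique (isLyonsExtension_signature X) I hst
  · obtain ⟨ℓ, hℓ⟩ := exists_pairing_near hT hK hKc hf (half_pos hε)
    refine ⟨ℓ, lt_of_le_of_lt (iSup₂_le fun X hX => ENNReal.ofReal_le_ofReal (hℓ X hX).le) ?_⟩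
    exact (ENNReal.ofReal_lt_ofReal_iff hε).2 (half_lt_self hε)

open RoughUAT in
theorem mainTheorem1 (p T : ℝ) (hp : 2 < p) (hp' : p < 3) (hT : 0 < T) (d : ℕ)
    (K : Set (RoughPath p T (ExtIndex d))) (hK : K ⊆ extendedRoughPaths p T d)
    (hKc : IsCompact K) (f : RoughPath p T (ExtIndex d) → ℝ) (hf : ContinuousOn f K)
    (L : ℝ) (hL : 0 < L) :
    -- Lyons' extension exists and is unique, so that `signature` below is meaningful
    (∀ X ∈ K, IsLyonsExtension X (signature X) ∧
      ∀ S, IsLyonsExtension X S → ∀ s t : ℝ, (s, t) ∈ simplex T → S s t = signature X s t) ∧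
    ∀ ε : ℝ, 0 < ε → ∃ ℓ : List (ExtIndex d) →₀ ℝ,
      (⨆ X ∈ boundedPart K L, ENNReal.ofReal |f X - pairing ℓ (signature X 0 T)|)
        < ENNReal.ofReal ε := by
  obtain ⟨hext, hdense⟩ := mainTheorem1_general p T hT d K hK hKc f hf
  exact ⟨fun X _ => hext X, fun ε hε => (hdense ε hε).imp fun ℓ hℓ =>
    (biSup_mono fun X hX => hX.1).trans_lt hℓ⟩
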